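/- \textbf{Setting.} An origami $S$ with $N$ squares is obtained from $N$ unit squares by gluing the right edge of square $i$ to the left edge of square $r(i)$ and the top edge of square $i$ to the bottom edge of square $u(i)$, where $r,u$ are permutations generating a transitive group. It is a ramified cover $\rho:S\to\mathbb{R}^2/\mathbb{Z}^2$. A period of $S$ is the holonomy $v\in\mathbb{C}=\mathbb{R}^2$ of a saddle connection, i.e. of a straight segment joining two conical singularities without singularities in its interior; $S$ is primitive if its periods generate $\mathbb{Z}^2$. For $A\in SL(2,\mathbb{Z})$, $A\cdot S=S'$ means that there is an affine homeomorphism $S\to S'$ with linear part $A$. Let $\mathcal{O}$ be the orbit B7: the set of primitive origamis with $7$ squares having a single conical singularity, of angle $6\pi$, and exactly three integer Weierstrass points (fixed points, at vertices of squares, of the affine involution with linear part $-1$). For $\alpha\in\mathbb{R}$ put $$L(S,\alpha):=\limsup_{|\mathrm{Im}(v)|\to\infty}\frac{1}{|\mathrm{Re}(v)|\cdot|\mathrm{Im}(v)|},$$ where $v$ runs over the periods of the surface obtained from $S$ by normalizing its area to $1$ and rotating it counterclockwise by $\arctan\alpha$. Write $[a_1,a_2,\dots]=\cfrac{1}{a_1+\cfrac{1}{a_2+\cdots}}$,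 where an overline denotes a period that is repeated. Let $T=\begin{pmatrix}1&1\\0&1\end{pmatrix}$, $R=\begin{pmatrix}0&-1\\1&0\end{pmatrix}$ and, for $n$ even, $g(a_1,\dots,a_n)=(T^{-a_n}R)(T^{a_{n-1}}R)\cdots(T^{-a_2}R)(T^{a_1}R)$. An even loop in $\mathcal{O}$ is a pair $(X,\alpha)$ with $X\in\mathcal{O}$ and $\alpha=[\overline{a_1,\dots,a_{2N}}]$ a quadratic irrational ($N\ge 1$, $a_i\ge1$) such that $g(a_1,\dots,a_{2N})\cdot X=X$. For $j\in\mathbb{Z}/7$ let $C_j=T^j\cdot C_0$ be the origami with squares indexed by $\mathbb{Z}/7$, $r(x)=x+1$ and $u(x)=u_0(x-j)$, where $(u_0(0),\dots,u_0(6))=(4,5,6,2,3,0,1)$. (These are the one-cylinder surfaces whose horizontal saddle connections have lengths $2,2,3$, numbered so that $R\cdot C_3=C_5$.) \textbf{Lemma.} The data $(C_6,[\overline{1,3}])$ and $(C_3,[\overline{5,2}])$ define even loops in $\mathcal{O}$, and $$L(C_6,[\overline{1,3}])=\phi_1=7+14\cdot[\overline{3,1}]=\frac{7\sqrt{21}}{3},$$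 $$L(C_3,[\overline{5,2}])=14\cdot[1,\overline{5,2}]=11.832159\pm10^{-6}.$$ -/

import Mathlib

open Filter Topology Set
open scoped MatrixGroups

noncomputable section

/-! ### Origamis and their flat geometry -/

/-- An origami (square-tiled surface) with `n` unit squares: the right edge of square `i` is glued to
the left edge of square `r i`, the top edge of square `i` to the bottom edge of square `u i`. -/
structure Origami (n : ℕ) where
  /-- the right neighbour -/
  r : Equiv.Perm (Fin n)
  /-- the upper neighbour -/
  u : Equiv.Perm (Fin n)
  /-- the surface is connected -/
  connected : ∀ i j : Fin n, ∃ g ∈ Subgroup.closure ({r, u} : Set (Equiv.Perm (Fin n))), g i = j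

/-- The torus `ℝ² / ℤ²`. -/
abbrev Torus : Type := UnitAddCircle × UnitAddCircle

/-- The linear action of `SL(2, ℤ)` on the torus. -/
def torusAct (A : SL(2, ℤ)) (p : Torus) : Torus :=
  (A.1 0 0 • p.1 + A.1 0 1 • p.2, A.1 1 0 • p.1 + A.1 1 1 • p.2)

/-- The class in the torus of a vector of `ℂ = ℝ²`. -/
def torusMk (z : ℂ) : Torus := ((z.re : UnitAddCircle), (z.im : UnitAddCircle))

namespace Origami

variable {n : ℕ}

/-- `n` disjoint copies of the closed unit square. -/
abbrev Squares (n : ℕ) : Type := Fin n × unitInterval × unitInterval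

/-- The identification of the edges of the squares. -/
inductive Glue (S : Origami n) : Squares n → Squares n → Prop
  | right (i : Fin n) (y : unitInterval) : Glue S (i, 1, y) (S.r i, 0, y)
  | up (i : Fin n) (x : unitInterval) : Glue S (i, x, 1) (S.u i, x, 0)

/-- The surface, as a topological space: the quotient of the squares by the gluing
(`Quot` is the quotient by the equivalence relation generated by `Glue`). -/
def Surface (S : Origami n) : Type := Quot S.Glue

instance (S : Origami n) : TopologicalSpace S.Surface :=
  inferInstanceAs (TopologicalSpace (Quot S.Glue))

/-- The point of the surface with coordinates `(x, y)` in the square `i`. -/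
def point (S : Origami n) (i : Fin n) (x y : unitInterval) : S.Surface := Quot.mk _ (i, x, y)

/-- The ramified covering `ρ` of the torus. -/
def proj (S : Origami n) : S.Surface → Torus :=
  Quot.lift (fun p => (((p.2.1 : ℝ) : UnitAddCircle), ((p.2.2 : ℝ) : UnitAddCircle))) (by
    rintro _ _ (⟨i, y⟩ | ⟨i, x⟩)
    · simp [AddCircle.coe_period]
    · simp [AddCircle.coe_period])

/-- Turning once counterclockwise, by the angle `2π`, around the lower left corner of a square,
through the squares to the left, below it, and back. The cycles of this permutation are the vertices
of the tiling, and the cone angle at a vertex is `2π` times the length of its cycle. -/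
def turn (S : Origami n) : Equiv.Perm (Fin n) := S.u * S.r * S.u⁻¹ * S.r⁻¹

/-- The set `Σ` of conical singularities, i.e. of the vertices with cone angle different from `2π`. -/
def sing (S : Origami n) : Set S.Surface := {x | ∃ i, S.turn i ≠ i ∧ x = S.point i 0 0}

/-- `S` belongs to the stratum `ℋ(2)`: there is exactly one conical singularity, with angle `6π`. -/
def IsH2 (S : Origami n) : Prop := S.turn.IsThreeCycle

/-- `γ` is a saddle connection with period `v` (for the metric in which the squares have side `1`):
a path joining two conical singularities with no singularity in its interior, and which is a straight
segment with holonomy `v`, that is, a lift under `ρ` of the segment `t ↦ t v` of the torus. -/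
structure IsSaddleConnection (S : Origami n) (γ : C(unitInterval, S.Surface)) (v : ℂ) : Prop where
  ne_zero : v ≠ 0
  source : γ 0 ∈ S.sing
  target : γ 1 ∈ S.sing
  interior : ∀ t : unitInterval, 0 < t → t < 1 → γ t ∉ S.sing
  straight : ∀ t : unitInterval, S.proj (γ t) = torusMk (((t : ℝ) : ℂ) * v)

/-- The set of periods of saddle connections, for squares of side `1`. -/
def hol (S : Origami n) : Set ℂ := {v | ∃ γ : C(unitInterval, S.Surface), S.IsSaddleConnection γ v}

/-- The set of periods after the normalization of the total area to `1`. -/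
def normHol (S : Origami n) : Set ℂ := (fun v => v / ((Real.sqrt n : ℝ) : ℂ)) '' S.hol

/-- `S` is primitive: the periods (for squares of side `1`) generate `ℤ²`. -/
def IsPrimitive (S : Origami n) : Prop :=
  (AddSubgroup.closure S.hol : Set ℂ) = {z | ∃ a b : ℤ, z = (a : ℂ) + (b : ℂ) * Complex.I}

/-- `A · S = S'` as translation surfaces, for `A ∈ SL(2, ℤ)`: there is an affine homeomorphism from
`S` to `S'` with linear part `A`. -/
def IsImage (A : SL(2, ℤ)) (S S' : Origami n) : Prop :=
  ∃ f : S.Surface ≃ₜ S'.Surface, ∀ x, S'.proj (f x) = torusAct A (S.proj x)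

/-- `S` has exactly three integer Weierstrass points: exactly three fixed points of the hyperelliptic
involution (the affine automorphism with linear part `-1`) are vertices of the tiling. -/
def HasThreeIntegerWeierstrassPoints (S : Origami n) : Prop :=
  ∃ f : S.Surface ≃ₜ S.Surface, (∀ x, S.proj (f x) = torusAct (-1) (S.proj x)) ∧
    {x : S.Surface | f x = x ∧ S.proj x = 0}.ncard = 3

/-- The orbit B7: primitive origamis with `7` squares in `ℋ(2)` with exactly three integer
Weierstrass points. -/
def orbitB7 : Set (Origami 7) :=
  {S | S.IsPrimitive ∧ S.IsH2 ∧ S.HasThreeIntegerWeierstrassPoints}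

/-! ### The function `L` -/

/-- `limsup 1 / (|Re v| |Im v|)` as `|Im v| → ∞`, over the `v` in a set of periods. -/
def lagrangeOfPeriods (P : Set ℂ) : ENNReal :=
  limsup (fun v : ℂ => (ENNReal.ofReal (|v.re| * |v.im|))⁻¹) (comap (fun v : ℂ => |v.im|) atTop ⊓ 𝓟 P)

/-- `L(S, α) = L(r_θ · S)` with `θ = arctan α`, where `r_θ` is the rotation by the angle `θ` and `S`
is normalized to have area `1`. -/
def lagrange (S : Origami n) (α : ℝ) : ENNReal :=
  lagrangeOfPeriods ((fun v => Complex.exp ((Real.arctan α : ℝ) * Complex.I) * v) '' S.normHol)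

end Origami

/-! ### Continued fractions -/

/-- `[a₀, …, a_{n-1}] = 1 / (a₀ + 1 / (a₁ + ⋯ + 1 / a_{n-1}))`. -/
def cfTrunc : ℕ → (ℕ → ℕ) → ℝ
  | 0, _ => 0
  | n + 1, a => 1 / ((a 0 : ℝ) + cfTrunc n (fun k => a (k + 1)))

/-- The infinite continued fraction `[a₀, a₁, …]` (without integer part). -/
def cf (a : ℕ → ℕ) : ℝ := limUnder atTop (fun n => cfTrunc n a)

theorem cfTrunc_nonneg (n : ℕ) : ∀ a : ℕ → ℕ, 0 ≤ cfTrunc n a := by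
  induction n with
  | zero => intro a; simp [cfTrunc]
  | succ n ih =>
    intro a
    have := ih (fun k => a (k + 1))
    simp only [cfTrunc]
    positivity

theorem cfTrunc_dist (n : ℕ) : ∀ a : ℕ → ℕ, (∀ k, 0 < a k) →
    |cfTrunc n a - cfTrunc (n + 1) a| ≤ 2 * (1 / 2 : ℝ) ^ n := by
  induction n using Nat.strong_induction_on with
  | _ n ih =>
    intro a ha
    have h1 : ∀ k, (1 : ℝ) ≤ a k := fun k => by exact_mod_cast ha k
    match n, ih with
    | 0, _ =>
      have h0 := h1 0
      simp only [cfTrunc]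
      rw [zero_sub, abs_neg, add_zero, abs_of_nonneg (by positivity), div_le_iff₀ (by positivity)]
      norm_num
      linarith
    | 1, _ =>
      have h0 := h1 0
      have h2 := h1 1
      have p1 : 0 ≤ cfTrunc 1 a := cfTrunc_nonneg _ _
      have p2 : 0 ≤ cfTrunc 2 a := cfTrunc_nonneg _ _
      have b : ∀ m, cfTrunc (m + 1) a ≤ 1 := by
        intro m
        have := cfTrunc_nonneg m (fun k => a (k + 1))
        simp only [cfTrunc]
        rw [div_le_one (by positivity)]
        linarith
      have b1 := b 0
      have b2 := b 1
      rw [abs_le]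
      norm_num at *
      constructor <;> linarith
    | n + 2, ih =>
      have key := ih n (by omega) (fun k => a (k + 2)) (fun k => ha _)
      have q1 := cfTrunc_nonneg n (fun k => a (k + 2))
      have q2 := cfTrunc_nonneg (n + 1) (fun k => a (k + 2))
      have e : ∀ m, cfTrunc (m + 2) a
          = 1 / ((a 0 : ℝ) + 1 / ((a 1 : ℝ) + cfTrunc m (fun k => a (k + 2)))) := fun m => rfl
      rw [e n, show n + 2 + 1 = (n + 1) + 2 from rfl, e (n + 1)]
      generalize cfTrunc n (fun k => a (k + 2)) = z at *
      generalize cfTrunc (n + 1) (fun k => a (k + 2)) = w at *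
      have h0 := h1 0
      have h2 := h1 1
      generalize (a 0 : ℝ) = x at *
      generalize (a 1 : ℝ) = y at *
      have pz : 2 ≤ x * (y + z) + 1 := by nlinarith
      have pw : 2 ≤ x * (y + w) + 1 := by nlinarith
      have hz : y + z ≠ 0 := by positivity
      have hw : y + w ≠ 0 := by positivity
      have hz' : x * (y + z) + 1 ≠ 0 := by positivity
      have hw' : x * (y + w) + 1 ≠ 0 := by positivity
      have : 1 / (x + 1 / (y + z)) - 1 / (x + 1 / (y + w))
          = (z - w) / ((x * (y + z) + 1) * (x * (y + w) + 1)) := by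
        have e1 : 1 / (x + 1 / (y + z)) = (y + z) / (x * (y + z) + 1) := by
          field_simp
        have e2 : 1 / (x + 1 / (y + w)) = (y + w) / (x * (y + w) + 1) := by
          field_simp
        rw [e1, e2, div_sub_div _ _ hz' hw']
        congr 1
        ring
      have hp : (4 : ℝ) ≤ (x * (y + z) + 1) * (x * (y + w) + 1) := by nlinarith
      rw [this, abs_div, abs_of_nonneg (by linarith : (0 : ℝ) ≤ (x * (y + z) + 1) * (x * (y + w) + 1)),
        div_le_iff₀ (by linarith)]
      have hq : (0 : ℝ) ≤ (1 / 2 : ℝ) ^ n := by positivity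
      rw [pow_add]
      nlinarith

/-- For positive entries the finite continued fractions do converge to `cf a`. -/
theorem tendsto_cf (a : ℕ → ℕ) (ha : ∀ k, 0 < a k) :
    Tendsto (fun n => cfTrunc n a) atTop (𝓝 (cf a)) := by
  have hc : CauchySeq (fun n => cfTrunc n a) := by
    refine cauchySeq_of_le_geometric (1 / 2) 2 (by norm_num) (fun n => ?_)
    rw [Real.dist_eq]
    exact cfTrunc_dist n a ha
  exact hc.tendsto_limUnder

/-- The sequence of entries `b₁, …, b_m, a₁, …, a_k, a₁, …, a_k, …`. -/
def periodicSeq (pre per : List ℕ) (n : ℕ) : ℕ :=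
  if n < pre.length then pre.getD n 0 else per.getD ((n - pre.length) % per.length) 0

/-- The number `[b₁, …, b_m, a₁, …, a_k]` with pre-period `b₁, …, b_m` and period `a₁, …, a_k`. -/
def periodicCF (pre per : List ℕ) : ℝ := cf (periodicSeq pre per)

/-! ### Even loops in the orbit B7 -/

/-- `(T^{±a_n} R) ⋯ (T^{-ε a₂} R) (T^{ε a₁} R)` with alternating signs, where
`T = (1 1; 0 1)` is `ModularGroup.T` and `R = (0 -1; 1 0)` is `ModularGroup.S`. -/
def gWordAux : ℤ → List ℕ → SL(2, ℤ)
  | _, [] => 1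
  | ε, a :: l => gWordAux (-ε) l * (ModularGroup.T ^ (ε * (a : ℤ)) * ModularGroup.S)

/-- `g(a₁, …, a_n) = (T^{±a_n} R) ⋯ (T^{-a₂} R) (T^{a₁} R)`. -/
def gWord (w : List ℕ) : SL(2, ℤ) := gWordAux 1 w

/-- `α` is a quadratic irrational. -/
def IsQuadraticIrrational (α : ℝ) : Prop :=
  Irrational α ∧ ∃ a b c : ℤ, a ≠ 0 ∧ (a : ℝ) * α ^ 2 + (b : ℝ) * α + (c : ℝ) = 0

/-- The datum `(X, α)`, where `α` has the purely periodic expansion with period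
`w = (a₁, …, a_{2N})`, is an even loop in the orbit B7: `g(a₁, …, a_{2N}) · X = X`. -/
structure IsEvenLoop (X : Origami 7) (w : List ℕ) : Prop where
  mem : X ∈ Origami.orbitB7
  ne_nil : w ≠ []
  even : Even w.length
  pos : ∀ a ∈ w, 0 < a
  quadratic : IsQuadraticIrrational (periodicCF [] w)
  loop : Origami.IsImage (gWord w) X X

/-- The upper neighbours in the element `C_0` of the cusp `C`: the squares `0, …, 6` form one
horizontal cylinder, the bottom side of which is made of three horizontal saddle connections, of
lengths `2`, `2`, `3` from left to right, and the top side of the same ones in the reversed order. -/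
def cuspCUp : Equiv.Perm (Fin 7) where
  toFun := ![4, 5, 6, 2, 3, 0, 1]
  invFun := ![5, 6, 3, 4, 0, 1, 2]
  left_inv := by decide
  right_inv := by decide

theorem cuspC_connected (u : Equiv.Perm (Fin 7)) (i j : Fin 7) :
    ∃ g ∈ Subgroup.closure ({Equiv.addRight 1, u} : Set (Equiv.Perm (Fin 7))), g i = j := by
  refine ⟨Equiv.addRight 1 ^ ((j - i : Fin 7) : ℕ),
    Subgroup.pow_mem _ (Subgroup.subset_closure (by simp)) _, ?_⟩
  revert i j
  decide

/-- The elements `C_0, …, C_6` of the cusp `C` of width `7` of the orbit B7, the only one without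
horizontal saddle connections of length `1`. Here `C_j = T^j · C_0`: the top of the cylinder is
twisted by `j`. Their numbering is the one for which `R · C_3 = C_5`. -/
def cuspC (j : Fin 7) : Origami 7 where
  r := Equiv.addRight 1
  u := cuspCUp * (Equiv.addRight j)⁻¹
  connected := cuspC_connected _

/-- `φ₁ = 7 + 14 [3, 1, 3, 1, …]`. -/
def phi1 : ℝ := 7 + 14 * periodicCF [] [3, 1]

end

/-!
Let `A` be the linear part of an affine automorphism of `S` which fixes the slope `α`. The quadratic
form `v ↦ v ∧ A v` is constant on the `A`-orbits of periods, and in the coordinates of the rotated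
surface of area `1` it is `n D (Re v Im v + E (Re v) ^ 2)` with `|D| = √((tr A) ^ 2 - 4)`. When
`|Im v| → ∞` while `Re v Im v` stays bounded the last term disappears, and the orbit of a period
realizes such a limit, so `L(S, α) = n √((tr A) ^ 2 - 4) / m` where `m` is the least absolute value
of the form on the periods of `S`.

For `A = g(a, b)` the form is `a x ^ 2 + a b x y - b y ^ 2`. By reduction theory a period on which
its absolute value is smaller than the claimed minimum `m` can be moved by a power of `A` to a
period `(x, y)` with `b y ^ 2 < m`. For the two loops this leaves, up to sign, the vectors with
`y = 0` and `y = 1`, and whether `(1, 0)` or `(k, 1)` is a period is read off the permutations `r`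
and `u`.
-/

noncomputable section

/-! ### The invariant form of a hyperbolic matrix -/

theorem coe_inv_fin_two (A : SL(2, ℤ)) : A⁻¹.1 = !![A.1 1 1, -A.1 0 1; -A.1 1 0, A.1 0 0] := by
  rw [Matrix.SpecialLinearGroup.coe_inv, Matrix.adjugate_fin_two]

theorem inv_mulVec_mulVec (A : SL(2, ℤ)) (v : Fin 2 → ℤ) : A⁻¹.1.mulVec (A.1.mulVec v) = v := by
  rw [Matrix.mulVec_mulVec, ← Matrix.SpecialLinearGroup.coe_mul, inv_mul_cancel,
    Matrix.SpecialLinearGroup.coe_one, Matrix.one_mulVec]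

theorem mulVec_inv_mulVec (A : SL(2, ℤ)) (v : Fin 2 → ℤ) : A.1.mulVec (A⁻¹.1.mulVec v) = v := by
  simpa using inv_mulVec_mulVec A⁻¹ v

theorem det_fin_two_eq_one (A : SL(2, ℤ)) : A.1 0 0 * A.1 1 1 - A.1 0 1 * A.1 1 0 = 1 := by
  rw [← Matrix.det_fin_two, A.2]

/-- The binary quadratic form `v ↦ v ∧ A v`, which is preserved by `A` and vanishes on the
eigenvectors of `A`. -/
def invariantForm (A : SL(2, ℤ)) (v : Fin 2 → ℤ) : ℤ :=
  v 0 * A.1.mulVec v 1 - v 1 * A.1.mulVec v 0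

theorem invariantForm_eq (A : SL(2, ℤ)) (v : Fin 2 → ℤ) :
    invariantForm A v =
      A.1 1 0 * v 0 ^ 2 + (A.1 1 1 - A.1 0 0) * v 0 * v 1 - A.1 0 1 * v 1 ^ 2 := by
  simp only [invariantForm, Matrix.mulVec, dotProduct, Fin.sum_univ_two]
  ring

theorem invariantForm_mulVec (A : SL(2, ℤ)) (v : Fin 2 → ℤ) :
    invariantForm A (A.1.mulVec v) = invariantForm A v := by
  simp only [invariantForm, Matrix.mulVec, dotProduct, Fin.sum_univ_two]
  linear_combination (A.1 1 0 * v 0 ^ 2 + (A.1 1 1 - A.1 0 0) * v 0 * v 1 - A.1 0 1 * v 1 ^ 2) *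
    det_fin_two_eq_one A

theorem invariantForm_inv_mulVec (A : SL(2, ℤ)) (v : Fin 2 → ℤ) :
    invariantForm A (A⁻¹.1.mulVec v) = invariantForm A v := by
  rw [← invariantForm_mulVec, mulVec_inv_mulVec]

theorem abs_trace_sub_two_mul_sq_le {A : SL(2, ℤ)} {v : Fin 2 → ℤ}
    (h : |v 1| ≤ |A.1.mulVec v 1|) (h' : |v 1| ≤ |A⁻¹.1.mulVec v 1|) :
    (|A.1.trace| - 2) * v 1 ^ 2 ≤ |A.1 1 0 * invariantForm A v| := by
  set y := A.1.mulVec v 1 with hy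
  set y' := A⁻¹.1.mulVec v 1 with hy'
  simp only [coe_inv_fin_two, Matrix.mulVec, dotProduct, Fin.sum_univ_two, Matrix.of_apply,
    Matrix.cons_val] at hy hy'
  have hsum : A.1.trace * v 1 = y + y' := by
    rw [Matrix.trace_fin_two, hy, hy']
    ring
  have hprod : y * y' = v 1 ^ 2 - A.1 1 0 * invariantForm A v := by
    rw [invariantForm_eq, hy, hy']
    linear_combination v 1 ^ 2 * det_fin_two_eq_one A
  have htri : |A.1.trace| * |v 1| ≤ |y| + |y'| := by
    rw [← abs_mul, hsum]
    exact abs_add_le y y'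
  have hprod_le : |y| * |y'| ≤ v 1 ^ 2 + |A.1 1 0 * invariantForm A v| := by
    rw [← abs_mul, hprod]
    exact (abs_sub _ _).trans_eq (by rw [abs_of_nonneg (sq_nonneg (v 1))])
  rw [← sq_abs] at hprod_le ⊢
  nlinarith [mul_nonneg (sub_nonneg.2 h) (sub_nonneg.2 h'),
    mul_le_mul_of_nonneg_left htri (abs_nonneg (v 1))]

/-- Reduction theory: in an orbit of `A`, a vector with minimal `|y|` is small. -/
theorem exists_reduced_invariantForm {A : SL(2, ℤ)} {P : (Fin 2 → ℤ) → Prop}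
    (hP : ∀ v, P (A.1.mulVec v) ↔ P v) {v : Fin 2 → ℤ} (hv : P v) :
    ∃ w, P w ∧ invariantForm A w = invariantForm A v ∧
      (|A.1.trace| - 2) * w 1 ^ 2 ≤ |A.1 1 0 * invariantForm A v| := by
  obtain ⟨w, ⟨hw, hwv⟩, hmin⟩ := exists_minimalFor_of_wellFoundedLT
    (fun w => P w ∧ invariantForm A w = invariantForm A v) (fun w => (w 1).natAbs) ⟨v, hv, rfl⟩
  have hmin_abs (w') (hw' : P w' ∧ invariantForm A w' = invariantForm A v) : |w 1| ≤ |w' 1| := by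
    have hle : (w 1).natAbs ≤ (w' 1).natAbs := (le_total _ _).elim id (hmin hw')
    simpa only [Int.natCast_natAbs] using Int.ofNat_le.2 hle
  refine ⟨w, hw, hwv, hwv ▸ abs_trace_sub_two_mul_sq_le (hmin_abs _ ⟨(hP w).2 hw, ?_⟩)
    (hmin_abs _ ⟨(hP _).1 ?_, ?_⟩)⟩
  · rw [invariantForm_mulVec, hwv]
  · rwa [mulVec_inv_mulVec]
  · rw [invariantForm_inv_mulVec, hwv]

theorem invariantForm_ne_zero {A : SL(2, ℤ)} (hA : 2 < |A.1.trace|) {v : Fin 2 → ℤ}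
    (hv : v ≠ 0) : invariantForm A v ≠ 0 := by
  intro h
  have hP (v : Fin 2 → ℤ) : A.1.mulVec v ≠ 0 ↔ v ≠ 0 := by
    refine not_congr ⟨fun h => ?_, fun h => by rw [h, Matrix.mulVec_zero]⟩
    rw [← inv_mulVec_mulVec A v, h, Matrix.mulVec_zero]
  obtain ⟨w, hw, hform, hle⟩ := exists_reduced_invariantForm (P := (· ≠ 0)) hP hv
  rw [h] at hform
  rw [h, mul_zero, abs_zero] at hle
  have hw₁ : w 1 = 0 := by
    by_contra hne
    exact hle.not_gt (mul_pos (sub_pos.2 hA) (by positivity))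
  have hw₀ : w 0 ≠ 0 := fun hw₀ => hw (funext fun i => by fin_cases i <;> assumption)
  have hc : A.1 1 0 = 0 := by simpa [invariantForm_eq, hw₁, hw₀] using hform
  have hdet : A.1 0 0 * A.1 1 1 = 1 := by simpa [hc] using det_fin_two_eq_one A
  rw [Matrix.trace_fin_two] at hA
  rcases Int.mul_eq_one_iff_eq_one_or_neg_one.1 hdet with ⟨ha, hd⟩ | ⟨ha, hd⟩ <;>
    norm_num [ha, hd] at hA

/-- `α` is fixed by the homography `A`, that is, `(α, 1)` is an eigenvector of `A`. -/
def IsFixedSlope (A : SL(2, ℤ)) (α : ℝ) : Prop :=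
  A.1 1 0 * α ^ 2 + (A.1 1 1 - A.1 0 0) * α - A.1 0 1 = 0

theorem IsFixedSlope.isQuadraticIrrational {A : SL(2, ℤ)} {α : ℝ} (hα : IsFixedSlope A α)
    (hA : 2 < |A.1.trace|) : IsQuadraticIrrational α := by
  unfold IsFixedSlope at hα
  constructor
  · rintro ⟨q, rfl⟩
    refine invariantForm_ne_zero hA (v := ![q.num, q.den]) (fun h => ?_) ?_
    · exact q.den_nz (by simpa using congrFun h 1)
    · have hnum : (q : ℝ) * q.den = q.num := by exact_mod_cast q.mul_den_eq_num
      rw [invariantForm_eq]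
      have : ((A.1 1 0 * q.num ^ 2 + (A.1 1 1 - A.1 0 0) * q.num * q.den -
          A.1 0 1 * q.den ^ 2 : ℤ) : ℝ) = 0 := by
        push_cast [← hnum]
        linear_combination (q.den : ℝ) ^ 2 * hα
      exact_mod_cast this
  · refine ⟨A.1 1 0, A.1 1 1 - A.1 0 0, -A.1 0 1, ?_, ?_⟩
    · simpa [invariantForm_eq] using invariantForm_ne_zero hA (v := ![1, 0]) (by simp)
    · push_cast
      linear_combination hα

theorem IsFixedSlope.inv {A : SL(2, ℤ)} {α : ℝ} (hα : IsFixedSlope A α) : IsFixedSlope A⁻¹ α := by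
  unfold IsFixedSlope at *
  simp only [coe_inv_fin_two, Matrix.of_apply, Matrix.cons_val]
  push_cast
  linear_combination -hα

theorem invariantForm_inv (A : SL(2, ℤ)) (v : Fin 2 → ℤ) :
    invariantForm A⁻¹ v = -invariantForm A v := by
  simp only [invariantForm_eq, coe_inv_fin_two, Matrix.of_apply, Matrix.cons_val]
  ring

/-- The eigenvalue of `A` on the linear form `(x, y) ↦ x - α y`. -/
def slopeEigenvalue (A : SL(2, ℤ)) (α : ℝ) : ℝ := A.1 0 0 - A.1 1 0 * α

section

variable {A : SL(2, ℤ)} {α : ℝ}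

theorem slopeEigenvalue_inv (A : SL(2, ℤ)) (α : ℝ) :
    slopeEigenvalue A⁻¹ α = A.1.trace - slopeEigenvalue A α := by
  simp only [slopeEigenvalue, coe_inv_fin_two, Matrix.of_apply, Matrix.cons_val,
    Matrix.trace_fin_two]
  push_cast
  ring

theorem IsFixedSlope.slopeEigenvalue_mul_inv (hα : IsFixedSlope A α) :
    slopeEigenvalue A α * slopeEigenvalue A⁻¹ α = 1 := by
  have hdet : (A.1 0 0 * A.1 1 1 - A.1 0 1 * A.1 1 0 : ℝ) = 1 := by
    exact_mod_cast det_fin_two_eq_one A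
  unfold IsFixedSlope at hα
  rw [slopeEigenvalue_inv, slopeEigenvalue, Matrix.trace_fin_two]
  push_cast
  linear_combination hdet - A.1 1 0 * hα

theorem IsFixedSlope.abs_slopeEigenvalue_ne_one (hα : IsFixedSlope A α)
    (hA : 2 < |A.1.trace|) : |slopeEigenvalue A α| ≠ 1 := by
  intro h
  have hinv : |slopeEigenvalue A⁻¹ α| = 1 := by
    simpa [abs_mul, h] using congrArg abs hα.slopeEigenvalue_mul_inv
  have htrace : (A.1.trace : ℝ) = slopeEigenvalue A α + slopeEigenvalue A⁻¹ α := by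
    rw [slopeEigenvalue_inv]
    ring
  have hle : |(A.1.trace : ℝ)| ≤ 2 := by
    rw [htrace]
    linarith [abs_add_le (slopeEigenvalue A α) (slopeEigenvalue A⁻¹ α)]
  exact hA.not_ge (by exact_mod_cast hle)

theorem IsFixedSlope.mulVec_sub_mul_mulVec (hα : IsFixedSlope A α) (v : Fin 2 → ℤ) :
    (A.1.mulVec v 0 - α * A.1.mulVec v 1 : ℝ) = slopeEigenvalue A α * (v 0 - α * v 1) := by
  unfold IsFixedSlope at hα
  simp only [slopeEigenvalue, Matrix.mulVec, dotProduct, Fin.sum_univ_two]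
  push_cast
  linear_combination -(v 1 : ℝ) * hα

theorem IsFixedSlope.exists_tendsto_sub_mul {P : (Fin 2 → ℤ) → Prop}
    (hP : ∀ v, P (A.1.mulVec v) ↔ P v) (hα : IsFixedSlope A α) (hA : 2 < |A.1.trace|)
    {v : Fin 2 → ℤ} (hv : P v) :
    ∃ p : ℕ → Fin 2 → ℤ, (∀ k, P (p k) ∧ |invariantForm A (p k)| = |invariantForm A v|) ∧
      Tendsto (fun k => (p k 0 - α * p k 1 : ℝ)) atTop (𝓝 0) := by
  wlog hμ : |slopeEigenvalue A α| < 1 generalizing A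
  · simp_rw [← abs_neg (invariantForm A _), ← invariantForm_inv]
    refine this (fun v => ?_) hα.inv ?_ ?_
    · rw [← hP, mulVec_inv_mulVec]
    · rwa [coe_inv_fin_two, Matrix.trace_fin_two_of, add_comm, ← Matrix.trace_fin_two]
    · have hgt := lt_of_le_of_ne (not_lt.1 hμ) (hα.abs_slopeEigenvalue_ne_one hA).symm
      have hmul := congrArg abs hα.slopeEigenvalue_mul_inv
      rw [abs_mul, abs_one] at hmul
      nlinarith [abs_nonneg (slopeEigenvalue A⁻¹ α)]
  · refine ⟨fun k => A.1.mulVec^[k] v, fun k => ?_, ?_⟩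
    · induction k with
      | zero => exact ⟨hv, rfl⟩
      | succ k ih => simpa only [Function.iterate_succ_apply', hP, invariantForm_mulVec] using ih
    · have hpow (k : ℕ) : ((A.1.mulVec^[k] v) 0 - α * (A.1.mulVec^[k] v) 1 : ℝ) =
          slopeEigenvalue A α ^ k * (v 0 - α * v 1) := by
        induction k with
        | zero => simp
        | succ k ih => rw [Function.iterate_succ_apply', hα.mulVec_sub_mul_mulVec, ih]; ring
      simp_rw [hpow]
      simpa using (tendsto_pow_atTop_nhds_zero_of_abs_lt_one hμ).mul_const (v 0 - α * v 1 : ℝ)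

end

/-! ### Periodic continued fractions -/

theorem cf_nonneg {a : ℕ → ℕ} (ha : ∀ k, 0 < a k) : 0 ≤ cf a :=
  ge_of_tendsto' (tendsto_cf a ha) fun n => cfTrunc_nonneg n a

theorem cf_eq_one_div {a : ℕ → ℕ} (ha : ∀ k, 0 < a k) :
    cf a = 1 / (a 0 + cf fun k => a (k + 1)) := by
  have hpos : (0 : ℝ) < a 0 := by exact_mod_cast ha 0
  have hnonneg : 0 ≤ cf fun k => a (k + 1) := cf_nonneg fun k => ha _
  refine tendsto_nhds_unique ((tendsto_add_atTop_iff_nat 1).2 (tendsto_cf a ha)) ?_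
  exact tendsto_const_nhds.div ((tendsto_cf _ fun k => ha (k + 1)).const_add _) (by positivity)

section

variable {pre per : List ℕ}

theorem periodicSeq_pos (hpre : ∀ a ∈ pre, 0 < a) (hper : ∀ a ∈ per, 0 < a) (hne : per ≠ [])
    (k : ℕ) : 0 < periodicSeq pre per k := by
  have hmod : (k - pre.length) % per.length < per.length :=
    Nat.mod_lt _ (List.length_pos_of_ne_nil hne)
  unfold periodicSeq
  split_ifs with hk
  · exact List.getD_eq_getElem _ _ hk ▸ hpre _ (List.getElem_mem hk)
  · exact List.getD_eq_getElem _ _ hmod ▸ hper _ (List.getElem_mem hmod)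

theorem periodicCF_cons {c : ℕ} (hc : 0 < c) (hpre : ∀ a ∈ pre, 0 < a) (hper : ∀ a ∈ per, 0 < a)
    (hne : per ≠ []) : periodicCF (c :: pre) per = 1 / (c + periodicCF pre per) := by
  have hseq : (fun k => periodicSeq (c :: pre) per (k + 1)) = periodicSeq pre per := by
    funext k
    simp [periodicSeq]
  rw [periodicCF,
    cf_eq_one_div (periodicSeq_pos (List.forall_mem_cons.2 ⟨hc, hpre⟩) hper hne), hseq]
  simp [periodicSeq, periodicCF]

theorem periodicCF_nil_left (per : List ℕ) : periodicCF [] per = periodicCF per per := by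
  refine congrArg cf (funext fun k => ?_)
  rcases lt_or_ge k per.length with hk | hk
  · simp [periodicSeq, hk, Nat.mod_eq_of_lt hk]
  · simp [periodicSeq, hk.not_gt, Nat.mod_eq_sub_mod hk]

end

section

variable {a b : ℕ} (ha : 0 < a) (hb : 0 < b)

include ha hb

theorem periodicCF_pair_nonneg : 0 ≤ periodicCF [] [a, b] :=
  cf_nonneg (periodicSeq_pos (by simp) (by simp [ha, hb]) (by simp))

theorem periodicCF_pair_quadratic :
    a * periodicCF [] [a, b] ^ 2 + a * b * periodicCF [] [a, b] - b = 0 := by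
  have hrec : periodicCF [] [a, b] = 1 / (a + 1 / (b + periodicCF [] [a, b])) := by
    conv_lhs => rw [periodicCF_nil_left, periodicCF_cons ha (by simp [hb]) (by simp [ha, hb])
      (by simp), periodicCF_cons hb (by simp) (by simp [ha, hb]) (by simp)]
  have hx := periodicCF_pair_nonneg ha hb
  generalize periodicCF [] [a, b] = x at hrec hx ⊢
  field_simp at hrec
  linear_combination hrec

theorem periodicCF_pair_eq :
    periodicCF [] [a, b] = (-(a * b) + √((a * b : ℝ) ^ 2 + 4 * (a * b))) / (2 * a) := by
  have hx := periodicCF_pair_nonneg ha hb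
  have hsqrt : √((a * b : ℝ) ^ 2 + 4 * (a * b)) = 2 * a * periodicCF [] [a, b] + a * b := by
    rw [Real.sqrt_eq_iff_mul_self_eq (by positivity) (by positivity)]
    linear_combination (-4 * a : ℝ) * periodicCF_pair_quadratic ha hb
  rw [hsqrt]
  field_simp
  ring

end

theorem periodicCF_three_one : periodicCF [] [3, 1] = (-3 + √21) / 6 := by
  rw [periodicCF_pair_eq (by norm_num) (by norm_num)]
  norm_num

theorem sqrt_140 : √(140 : ℝ) = 2 * √35 := by
  rw [show (140 : ℝ) = 2 ^ 2 * 35 by norm_num, Real.sqrt_mul (by norm_num),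
    Real.sqrt_sq (by norm_num)]

theorem periodicCF_one_five_two : periodicCF [1] [5, 2] = √35 / 7 := by
  have hsq : √35 * √35 = (35 : ℝ) := Real.mul_self_sqrt (by norm_num)
  rw [periodicCF_cons one_pos (by simp) (by simp) (by simp),
    periodicCF_pair_eq (by norm_num) (by norm_num)]
  norm_num [sqrt_140]
  field_simp
  linear_combination -2 * hsq

theorem phi1_eq : phi1 = 7 * √21 / 3 := by
  rw [phi1, periodicCF_three_one]
  ring

open ModularGroup in
theorem gWord_pair (a b : ℕ) : gWord [a, b] = T ^ (-(b : ℤ)) * (S * (T ^ (a : ℤ) * S)) := by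
  simp [gWord, gWordAux, mul_assoc]

theorem gWord_pair_val (a b : ℕ) : (gWord [a, b]).1 = !![-(a * b + 1 : ℤ), b; a, -1] := by
  simp only [gWord_pair, Matrix.SpecialLinearGroup.coe_mul, ModularGroup.coe_T_zpow,
    ModularGroup.coe_S]
  ext i j
  fin_cases i <;> fin_cases j <;> simp [mul_comm, add_comm]

theorem trace_gWord_pair (a b : ℕ) : (gWord [a, b]).1.trace = -(a * b + 2 : ℤ) := by
  rw [gWord_pair_val, Matrix.trace_fin_two_of]
  ring

theorem two_lt_abs_trace_gWord_pair {a b : ℕ} (ha : 0 < a) (hb : 0 < b) :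
    2 < |(gWord [a, b]).1.trace| := by
  rw [trace_gWord_pair, abs_neg, abs_of_nonneg (by positivity)]
  have : 0 < (a * b : ℤ) := by positivity
  linarith

theorem invariantForm_gWord_pair (a b : ℕ) (v : Fin 2 → ℤ) :
    invariantForm (gWord [a, b]) v = a * v 0 ^ 2 + a * b * v 0 * v 1 - b * v 1 ^ 2 := by
  rw [invariantForm_eq, gWord_pair_val]
  simp only [Matrix.of_apply, Matrix.cons_val]
  ring

theorem isFixedSlope_gWord_pair {a b : ℕ} (ha : 0 < a) (hb : 0 < b) :
    IsFixedSlope (gWord [a, b]) (periodicCF [] [a, b]) := by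
  rw [IsFixedSlope, gWord_pair_val]
  simp only [Matrix.of_apply, Matrix.cons_val]
  push_cast
  linear_combination periodicCF_pair_quadratic ha hb

namespace Origami

variable {n : ℕ}

section

variable (S : Origami n)

/-! ### Points of the surface -/

theorem point_right (i : Fin n) (y : unitInterval) : S.point i 1 y = S.point (S.r i) 0 y :=
  Quot.sound (Glue.right i y)

theorem point_up (i : Fin n) (x : unitInterval) : S.point i x 1 = S.point (S.u i) x 0 :=
  Quot.sound (Glue.up i x)

theorem exists_point (p : S.Surface) : ∃ i x y, p = S.point i x y := by
  induction p using Quot.ind with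
  | mk a => exact ⟨a.1, a.2.1, a.2.2, rfl⟩

theorem proj_point (i : Fin n) (x y : unitInterval) :
    S.proj (S.point i x y) = (((x : ℝ) : UnitAddCircle), ((y : ℝ) : UnitAddCircle)) := rfl

theorem continuous_point (i : Fin n) :
    Continuous fun p : unitInterval × unitInterval => S.point i p.1 p.2 :=
  continuous_quot_mk.comp (Continuous.prodMk_right i)

theorem exists_point_lt_one (p : S.Surface) : ∃ i x y, p = S.point i x y ∧ x < 1 ∧ y < 1 := by
  have hright (i) (x y : unitInterval) : ∃ j x', S.point i x y = S.point j x' y ∧ x' < 1 := by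
    rcases eq_or_ne x 1 with rfl | hx
    · exact ⟨_, _, S.point_right i y, zero_lt_one⟩
    · exact ⟨_, _, rfl, lt_of_le_of_ne x.2.2 hx⟩
  obtain ⟨i, x, y, rfl⟩ := S.exists_point p
  rcases eq_or_ne y 1 with rfl | hy
  · obtain ⟨j, x', h, hx'⟩ := hright (S.u i) x 0
    exact ⟨j, x', 0, (S.point_up i x).trans h, hx', zero_lt_one⟩
  · obtain ⟨j, x', h, hx'⟩ := hright i x y
    exact ⟨j, x', y, h, hx', lt_of_le_of_ne y.2.2 hy⟩

theorem unitAddCircle_coe_injOn : InjOn (fun x : ℝ => (x : UnitAddCircle)) (Ico 0 1) := by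
  have : Fact ((0 : ℝ) < 1) := ⟨one_pos⟩
  intro x hx y hy h
  exact (AddCircle.coe_eq_coe_iff_of_mem_Ico (p := (1 : ℝ)) (a := 0)
    (by simpa using hx) (by simpa using hy)).1 h

variable {S} in
theorem exists_eq_point_of_proj_eq {p : S.Surface} {x y : unitInterval} (hx : x < 1) (hy : y < 1)
    (h : S.proj p = (((x : ℝ) : UnitAddCircle), ((y : ℝ) : UnitAddCircle))) :
    ∃ i, p = S.point i x y := by
  obtain ⟨i, x', y', rfl, hx', hy'⟩ := S.exists_point_lt_one p
  rw [proj_point, Prod.mk.injEq] at h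
  have hxx : x' = x := Subtype.ext (unitAddCircle_coe_injOn ⟨x'.2.1, hx'⟩ ⟨x.2.1, hx⟩ h.1)
  have hyy : y' = y := Subtype.ext (unitAddCircle_coe_injOn ⟨y'.2.1, hy'⟩ ⟨y.2.1, hy⟩ h.2)
  exact ⟨i, by rw [hxx, hyy]⟩

/-- The vertex of the tiling at the lower left corner of the square `i`. -/
def vertex (i : Fin n) : S.Surface := S.point i 0 0

theorem proj_vertex (i : Fin n) : S.proj (S.vertex i) = 0 := by
  simp [vertex, proj_point, Prod.zero_eq_mk]

variable {S} in
theorem exists_eq_vertex_of_proj_eq_zero {p : S.Surface} (h : S.proj p = 0) :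
    ∃ i, p = S.vertex i :=
  exists_eq_point_of_proj_eq zero_lt_one zero_lt_one (by simpa [Prod.zero_eq_mk] using h)

theorem turn_r_u (i : Fin n) : S.turn (S.r (S.u i)) = S.u (S.r i) := by
  simp [turn]

theorem vertex_turn (i : Fin n) : S.vertex (S.turn i) = S.vertex i := by
  obtain ⟨j, rfl⟩ : ∃ j, S.r (S.u j) = i := ⟨S.u⁻¹ (S.r⁻¹ i), by simp⟩
  rw [turn_r_u, vertex, vertex, ← point_up, ← point_right, point_up, point_right]

/-- The continuous function on the surface which interpolates bilinearly, in each square, the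
values at the vertices prescribed by a function `c` constant on the cycles of `turn`. -/
def vertexFun (c : Fin n → ℝ) (hc : ∀ i, c (S.turn i) = c i) : S.Surface → ℝ :=
  Quot.lift (fun p => (1 - (p.2.1 : ℝ)) * (1 - p.2.2) * c p.1 + p.2.1 * (1 - p.2.2) * c (S.r p.1)
    + (1 - p.2.1) * p.2.2 * c (S.u p.1) + p.2.1 * p.2.2 * c (S.u (S.r p.1))) (by
    rintro _ _ (⟨i, y⟩ | ⟨i, x⟩)
    · simp
    · have := hc (S.r (S.u i))
      rw [turn_r_u] at this
      simp [this])

theorem continuous_vertexFun (c : Fin n → ℝ) (hc : ∀ i, c (S.turn i) = c i) :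
    Continuous (S.vertexFun c hc) := by
  refine continuous_quot_lift _ (continuous_prod_of_discrete_left.2 fun i => ?_)
  fun_prop

theorem vertexFun_vertex (c : Fin n → ℝ) (hc : ∀ i, c (S.turn i) = c i) (i : Fin n) :
    S.vertexFun c hc (S.vertex i) = c i := by
  simp [vertexFun, vertex, point]

theorem sameCycle_of_forall_eq {α : Type*} {f : Equiv.Perm α} {x y : α}
    (h : ∀ c : α → ℝ, (∀ z, c (f z) = c z) → c x = c y) : f.SameCycle x y := by
  classical
  have hxy := h (fun z => if f.SameCycle x z then 1 else 0) (by simp)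
  by_contra hcyc
  simp [hcyc, Equiv.Perm.SameCycle.refl] at hxy

theorem vertex_eq_vertex_iff {i j : Fin n} : S.vertex i = S.vertex j ↔ S.turn.SameCycle i j := by
  constructor
  · intro h
    refine sameCycle_of_forall_eq fun c hc => ?_
    rw [← S.vertexFun_vertex c hc i, h, vertexFun_vertex]
  · rintro ⟨k, rfl⟩
    induction k with
    | zero => rfl
    | succ k ih => rw [add_comm, zpow_add, zpow_one, Equiv.Perm.mul_apply, vertex_turn, ih]
    | pred k ih =>
      have hk : S.turn ((S.turn ^ (-(k : ℤ) - 1)) i) = (S.turn ^ (-(k : ℤ))) i := by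
        rw [← Equiv.Perm.mul_apply, ← zpow_one_add, add_sub_cancel]
      rw [ih, ← hk, vertex_turn]

theorem vertex_mem_sing_iff {i : Fin n} : S.vertex i ∈ S.sing ↔ S.turn i ≠ i := by
  refine ⟨?_, fun h => ⟨i, h, rfl⟩⟩
  rintro ⟨j, hj, h⟩ hi
  have hij : i = j := (S.vertex_eq_vertex_iff.1 h).eq_of_left hi
  exact hj (hij ▸ hi)

variable {S} in
theorem eq_of_forall_vertexFun_eq {p q : S.Surface} (hp : S.proj p = 0) (hq : S.proj q = 0)
    (h : ∀ c hc, S.vertexFun c hc p = S.vertexFun c hc q) : p = q := by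
  obtain ⟨i, rfl⟩ := exists_eq_vertex_of_proj_eq_zero hp
  obtain ⟨j, rfl⟩ := exists_eq_vertex_of_proj_eq_zero hq
  refine S.vertex_eq_vertex_iff.2 (sameCycle_of_forall_eq fun c hc => ?_)
  simpa only [vertexFun_vertex] using h c hc

/-! ### Lifting a horizontal edge -/

/-- A continuous function on the surface which on the bottom edge of the square `i` is
`d i * x * (1 - x)`: it tells the horizontal edges apart. -/
def edgeFun (d : Fin n → ℝ) : S.Surface → ℝ :=
  Quot.lift (fun p => (p.2.1 : ℝ) * (1 - p.2.1) * ((1 - p.2.2) * d p.1 + p.2.2 * d (S.u p.1))) (by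
    rintro _ _ (⟨i, y⟩ | ⟨i, x⟩) <;> simp)

theorem continuous_edgeFun (d : Fin n → ℝ) : Continuous (S.edgeFun d) := by
  refine continuous_quot_lift _ (continuous_prod_of_discrete_left.2 fun i => ?_)
  fun_prop

theorem edgeFun_point_zero (d : Fin n → ℝ) (i : Fin n) (x : unitInterval) :
    S.edgeFun d (S.point i x 0) = (x : ℝ) * (1 - x) * d i := by
  simp [edgeFun, point]

variable {S} in
theorem exists_eqOn_point_of_proj_eq (γ : C(unitInterval, S.Surface))
    (hγ : ∀ t, S.proj (γ t) = (((t : ℝ) : UnitAddCircle), 0)) :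
    ∃ i, EqOn γ (fun t => S.point i t 0) (Ioo 0 1) := by
  have hpt (t : unitInterval) (ht : t < 1) : ∃ i, γ t = S.point i t 0 :=
    exists_eq_point_of_proj_eq ht zero_lt_one (by simpa using hγ t)
  have hden (t : unitInterval) (ht : t ∈ Ioo (0 : unitInterval) 1) : (t : ℝ) * (1 - t) ≠ 0 :=
    have h₀ : (0 : ℝ) < t := ht.1
    have h₁ : (t : ℝ) < 1 := ht.2
    (mul_pos h₀ (by linarith)).ne'
  let label : unitInterval → ℝ := fun t => S.edgeFun (fun i => (i : ℕ)) (γ t) / (t * (1 - t))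
  have hlabel (t) (ht : t ∈ Ioo (0 : unitInterval) 1) (i) (h : γ t = S.point i t 0) :
      label t = (i : ℕ) := by
    simp only [label, h, edgeFun_point_zero]
    exact mul_div_cancel_left₀ _ (hden t ht)
  have hcont : ContinuousOn label (Ioo 0 1) := by
    refine ContinuousOn.div ?_ (by fun_prop) hden
    exact ((S.continuous_edgeFun _).comp γ.continuous).continuousOn
  have hmaps : MapsTo label (Ioo 0 1) (range fun i : Fin n => ((i : ℕ) : ℝ)) := fun t ht => by
    obtain ⟨i, hi⟩ := hpt t ht.2
    exact ⟨i, (hlabel t ht i hi).symm⟩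
  obtain ⟨s, hs⟩ : (Ioo (0 : unitInterval) 1).Nonempty := nonempty_Ioo.2 zero_lt_one
  obtain ⟨i, hi⟩ := hpt s hs.2
  refine ⟨i, fun t ht => ?_⟩
  obtain ⟨j, hj⟩ := hpt t ht.2
  have hji : ((j : ℕ) : ℝ) = (i : ℕ) := by
    rw [← hlabel t ht j hj, ← hlabel s hs i hi]
    exact isPreconnected_Ioo.constant_of_mapsTo (finite_range _).isDiscrete hcont hmaps ht hs
  rw [hj, Fin.ext (Nat.cast_injective hji)]

variable {S} in
theorem exists_eq_point_of_forall_proj_eq (γ : C(unitInterval, S.Surface))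
    (hγ : ∀ t, S.proj (γ t) = (((t : ℝ) : UnitAddCircle), 0)) :
    ∃ i, γ 0 = S.vertex i ∧ γ 1 = S.vertex (S.r i) ∧
      ∀ t ∈ Ioo (0 : unitInterval) 1, γ t = S.point i t 0 := by
  obtain ⟨i, hi⟩ := exists_eqOn_point_of_proj_eq γ hγ
  have hedge : Continuous fun t => S.point i t 0 :=
    (S.continuous_point i).comp (Continuous.prodMk_left 0)
  have hfun (c hc) : S.vertexFun c hc ∘ γ = S.vertexFun c hc ∘ fun t => S.point i t 0 := by
    have hdense : Dense (Ioo (0 : unitInterval) 1) := by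
      rw [dense_iff_closure_eq, closure_Ioo zero_ne_one]
      exact Icc_bot_top
    exact ((S.continuous_vertexFun c hc).comp γ.continuous).ext_on hdense
      ((S.continuous_vertexFun c hc).comp hedge) fun t ht => congrArg _ (hi ht)
  refine ⟨i, ?_, ?_, hi⟩
  · exact eq_of_forall_vertexFun_eq (by simpa [Prod.zero_eq_mk] using hγ 0)
      (S.proj_vertex i)
      fun c hc => congrFun (hfun c hc) 0
  · rw [vertex, ← point_right]
    exact eq_of_forall_vertexFun_eq
      (by simpa [Prod.zero_eq_mk, AddCircle.coe_period] using hγ 1)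
      (by rw [point_right]; exact S.proj_vertex _)
      fun c hc => congrFun (hfun c hc) 1

/-! ### Affine homeomorphisms -/

theorem torusAct_one (p : Torus) : torusAct 1 p = p := by
  simp [torusAct]

theorem torusAct_mul (A B : SL(2, ℤ)) (p : Torus) :
    torusAct (A * B) p = torusAct A (torusAct B p) := by
  simp only [torusAct, Matrix.SpecialLinearGroup.coe_mul, Matrix.mul_apply, Fin.sum_univ_two,
    Prod.mk.injEq, add_smul, mul_smul, smul_add]
  constructor <;> abel

/-- `A · S = S'`, by an affine homeomorphism which sends the lower left corner of the square `i`
to the lower left corner of the square `τ i`. -/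
def IsImageVia (A : SL(2, ℤ)) (τ : Equiv.Perm (Fin n)) (S S' : Origami n) : Prop :=
  ∃ f : S.Surface ≃ₜ S'.Surface, (∀ x, S'.proj (f x) = torusAct A (S.proj x)) ∧
    ∀ i, f (S.vertex i) = S'.vertex (τ i)

namespace IsImageVia

variable {A B : SL(2, ℤ)} {τ ρ : Equiv.Perm (Fin n)} {S S' S'' : Origami n}

theorem isImage : IsImageVia A τ S S' → IsImage A S S' := fun ⟨f, hf, _⟩ => ⟨f, hf⟩

theorem trans (hB : IsImageVia B ρ S' S'') (hA : IsImageVia A τ S S') :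
    IsImageVia (B * A) (ρ * τ) S S'' := by
  obtain ⟨f, hf, hfτ⟩ := hA
  obtain ⟨g, hg, hgρ⟩ := hB
  exact ⟨f.trans g, fun x => by simp [hg, hf, torusAct_mul], fun i => by simp [hfτ, hgρ]⟩

theorem symm (hA : IsImageVia A τ S S') : IsImageVia A⁻¹ τ⁻¹ S' S := by
  obtain ⟨f, hf, hfτ⟩ := hA
  refine ⟨f.symm, fun x => ?_, fun i => ?_⟩
  · obtain ⟨x, rfl⟩ := f.surjective x
    rw [f.symm_apply_apply, hf, ← torusAct_mul, inv_mul_cancel, torusAct_one]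
  · obtain ⟨i, rfl⟩ := τ.surjective i
    simp [← hfτ]

end IsImageVia

/-- Renumbering the squares along `σ` identifies `T ^ k · S` with `S'`. The point `(x, 1)` of the
square `i` of `S` is sheared to the point `(x, 1)` of the square `r ^ k i`, whence the shape of
`u_apply`. -/
structure IsShear (k : ℤ) (σ : Equiv.Perm (Fin n)) (S S' : Origami n) : Prop where
  r_apply : ∀ i, S'.r (σ i) = σ (S.r i)
  u_apply : ∀ i, S'.u (σ ((S.r ^ k) i)) = σ (S.u i)

/-- The point at the position `(x, y)` of the infinite horizontal strip which starts with the
bottom left corner of the square `i` and runs through the squares `r ^ k i`. -/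
def stripPoint (i : Fin n) (x : ℝ) (y : unitInterval) : S.Surface :=
  S.point ((S.r ^ ⌊x⌋) i) ⟨Int.fract x, Int.fract_nonneg x, (Int.fract_lt_one x).le⟩ y

theorem stripPoint_add_int (i : Fin n) (x : ℝ) (k : ℤ) (y : unitInterval) :
    S.stripPoint i (x + k) y = S.stripPoint ((S.r ^ k) i) x y := by
  simp [stripPoint, zpow_add]

theorem stripPoint_coe (i : Fin n) (x y : unitInterval) : S.stripPoint i x y = S.point i x y := by
  rcases x.2.2.lt_or_eq with hx | hx
  · have hfloor : ⌊(x : ℝ)⌋ = 0 := Int.floor_eq_zero_iff.2 ⟨x.2.1, hx⟩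
    simp [stripPoint, Int.fract, hfloor]
  · obtain rfl : x = 1 := Subtype.ext hx
    simp [stripPoint, point_right]

theorem proj_stripPoint (i : Fin n) (x : ℝ) (y : unitInterval) :
    S.proj (S.stripPoint i x y) = ((x : UnitAddCircle), ((y : ℝ) : UnitAddCircle)) := by
  rw [stripPoint, proj_point, AddCircle.coe_fract]

theorem continuous_stripPoint (i : Fin n) :
    Continuous fun p : ℝ × unitInterval => S.stripPoint i p.1 p.2 := by
  have hfin : LocallyFinite fun k : ℤ => Icc (k : ℝ) (k + 1) := by
    simpa using locallyFinite_Icc_of_tendsto (tendsto_intCast_atTop_atTop (R := ℝ))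
      (tendsto_atBot_add_const_right _ (1 : ℝ) (tendsto_intCast_atBot_iff.2 tendsto_id))
  refine (hfin.preimage_continuous continuous_fst).continuous ?_ ?_ ?_
  · exact eq_univ_of_forall fun p =>
      mem_iUnion.2 ⟨⌊p.1⌋, Int.floor_le _, (Int.lt_floor_add_one _).le⟩
  · exact fun k => isClosed_Icc.preimage continuous_fst
  · intro k
    have hpoint : Continuous fun p : ℝ × unitInterval =>
        S.point ((S.r ^ k) i) (projIcc 0 1 zero_le_one (p.1 - k)) p.2 :=
      (S.continuous_point _).comp (f := fun p : ℝ × unitInterval =>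
        (projIcc 0 1 zero_le_one (p.1 - k), p.2)) (by fun_prop)
    refine hpoint.continuousOn.congr fun p hp => ?_
    obtain ⟨h₀, h₁⟩ : (k : ℝ) ≤ p.1 ∧ p.1 ≤ k + 1 := hp
    have hx : p.1 - k ∈ Icc (0 : ℝ) 1 := ⟨by linarith, by linarith⟩
    simp only [projIcc_of_mem zero_le_one hx]
    rw [← stripPoint_coe, ← stripPoint_add_int, sub_add_cancel]

namespace IsShear

variable {k : ℤ} {σ : Equiv.Perm (Fin n)} {S S' : Origami n}

theorem r_zpow_apply (h : IsShear k σ S S') (m : ℤ) (i : Fin n) :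
    (S'.r ^ m) (σ i) = σ ((S.r ^ m) i) := by
  have hsemi : SemiconjBy σ S.r S'.r := Equiv.ext fun i => (h.r_apply i).symm
  exact (DFunLike.congr_fun (hsemi.zpow_right m) i).symm

theorem symm (h : IsShear k σ S S') : IsShear (-k) σ⁻¹ S' S where
  r_apply i := by
    obtain ⟨i, rfl⟩ := σ.surjective i
    simp [h.r_apply]
  u_apply i := by
    obtain ⟨i, rfl⟩ := σ.surjective i
    obtain ⟨i, rfl⟩ := (S.r ^ k).surjective i
    rw [h.r_zpow_apply, h.u_apply]
    simp

/-- The shear `(x, y) ↦ (x + k y, y)`, as a map from `S` to `S'`. -/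
def map (h : IsShear k σ S S') : S.Surface → S'.Surface :=
  Quot.lift (fun p => S'.stripPoint (σ p.1) (p.2.1 + k * p.2.2) p.2.2) (by
    rintro _ _ (⟨i, y⟩ | ⟨i, x⟩)
    · have := S'.stripPoint_add_int (σ i) (k * y) 1 y
      simpa [h.r_apply, add_comm] using this
    · simp [stripPoint_add_int, stripPoint_coe, h.r_zpow_apply, point_up, h.u_apply])

theorem map_point (h : IsShear k σ S S') (i : Fin n) (x y : unitInterval) :
    h.map (S.point i x y) = S'.stripPoint (σ i) (x + k * y) y := rfl

theorem map_stripPoint (h : IsShear k σ S S') (i : Fin n) (x : ℝ) (y : unitInterval) :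
    h.map (S.stripPoint i x y) = S'.stripPoint (σ i) (x + k * y) y := by
  rw [stripPoint, map_point, ← h.r_zpow_apply, ← stripPoint_add_int]
  congr 1
  linarith [Int.fract_add_floor x]

theorem map_symm_map (h : IsShear k σ S S') (p : S.Surface) : h.symm.map (h.map p) = p := by
  obtain ⟨i, x, y, rfl⟩ := S.exists_point p
  rw [map_point, map_stripPoint]
  simp [stripPoint_coe]

theorem map_map_symm (h : IsShear k σ S S') (p : S'.Surface) : h.map (h.symm.map p) = p := by
  obtain ⟨i, x, y, rfl⟩ := S'.exists_point p
  rw [map_point, map_stripPoint]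
  simp [stripPoint_coe]

theorem continuous_map (h : IsShear k σ S S') : Continuous h.map := by
  refine continuous_quot_lift _ (continuous_prod_of_discrete_left.2 fun i => ?_)
  exact (S'.continuous_stripPoint (σ i)).comp
    (f := fun p : unitInterval × unitInterval => ((p.1 : ℝ) + k * p.2, p.2)) (by fun_prop)

/-- The shear `(x, y) ↦ (x + k y, y)`, as a homeomorphism from `S` to `S'`. -/
def homeo (h : IsShear k σ S S') : S.Surface ≃ₜ S'.Surface where
  toFun := h.map
  invFun := h.symm.map
  left_inv := h.map_symm_map
  right_inv := h.map_map_symm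
  continuous_toFun := h.continuous_map
  continuous_invFun := h.symm.continuous_map

theorem homeo_point (h : IsShear k σ S S') (i : Fin n) (x y : unitInterval) :
    h.homeo (S.point i x y) = S'.stripPoint (σ i) (x + k * y) y := rfl

theorem isImageVia (h : IsShear k σ S S') : IsImageVia (ModularGroup.T ^ k) σ S S' := by
  refine ⟨h.homeo, fun p => ?_, fun i => ?_⟩
  · obtain ⟨i, x, y, rfl⟩ := S.exists_point p
    rw [homeo_point, proj_stripPoint, proj_point]
    simp [torusAct, ModularGroup.coe_T_zpow, ← zsmul_eq_mul]
  · rw [vertex, homeo_point]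
    simpa [map_point, vertex] using S'.stripPoint_coe (σ i) 0 0

end IsShear

/-! ### The generators of the modular group -/

variable {S} in
theorem connected_of_mem {r u : Equiv.Perm (Fin n)} (hr : S.r ∈ Subgroup.closure {r, u})
    (hu : S.u ∈ Subgroup.closure {r, u}) (i j : Fin n) :
    ∃ g ∈ Subgroup.closure ({r, u} : Set (Equiv.Perm (Fin n))), g i = j := by
  obtain ⟨g, hg, hij⟩ := S.connected i j
  exact ⟨g, (Subgroup.closure_le _).2 (by rintro _ (rfl | rfl) <;> assumption) hg, hij⟩

/-- The origami `T ^ k · S`, with the numbering of the squares for which the bottom left corners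
do not move. -/
def shear (k : ℤ) : Origami n where
  r := S.r
  u := S.u * (S.r ^ k)⁻¹
  connected := by
    have hr : S.r ∈ Subgroup.closure {S.r, S.u * (S.r ^ k)⁻¹} :=
      Subgroup.subset_closure (by simp)
    have hu : S.u * (S.r ^ k)⁻¹ ∈ Subgroup.closure {S.r, S.u * (S.r ^ k)⁻¹} :=
      Subgroup.subset_closure (by simp)
    exact connected_of_mem hr (by simpa using mul_mem hu (zpow_mem hr k))

theorem isShear_shear (k : ℤ) : IsShear k 1 S (S.shear k) where
  r_apply _ := rfl
  u_apply i := by simp [shear]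

/-- The origami `R · S`, obtained by rotating every square by a quarter turn in place. -/
def rotate : Origami n where
  r := S.u⁻¹
  u := S.r
  connected := connected_of_mem (S := S) (Subgroup.subset_closure (by simp))
    (by rw [← inv_inv S.u]; exact inv_mem (Subgroup.subset_closure (by simp)))

/-- The rotation by a quarter turn, as a homeomorphism from `S` to `R · S`. -/
def rotateHomeo : S.Surface ≃ₜ S.rotate.Surface where
  toFun := Quot.lift (fun p => S.rotate.point p.1 (unitInterval.symm p.2.2) p.2.1) (by
    rintro _ _ (⟨i, y⟩ | ⟨i, x⟩)
    · simp [point_up, rotate]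
    · simpa [rotate] using (S.rotate.point_right (S.u i) x).symm)
  invFun := Quot.lift (fun p => S.point p.1 p.2.2 (unitInterval.symm p.2.1)) (by
    rintro _ _ (⟨i, y⟩ | ⟨i, x⟩)
    · simp [point_up, rotate]
    · simp [point_right, rotate])
  left_inv p := by
    obtain ⟨i, x, y, rfl⟩ := S.exists_point p
    exact congrArg (fun z => S.point i x z) (unitInterval.symm_symm y)
  right_inv p := by
    obtain ⟨i, x, y, rfl⟩ := S.rotate.exists_point p
    exact congrArg (fun z => S.rotate.point i z y) (unitInterval.symm_symm x)
  continuous_toFun := continuous_quot_lift _ <| continuous_prod_of_discrete_left.2 fun i =>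
    (S.rotate.continuous_point i).comp
      (f := fun p : unitInterval × unitInterval => (unitInterval.symm p.2, p.1)) (by fun_prop)
  continuous_invFun := continuous_quot_lift _ <| continuous_prod_of_discrete_left.2 fun i =>
    (S.continuous_point i).comp
      (f := fun p : unitInterval × unitInterval => (p.2, unitInterval.symm p.1)) (by fun_prop)

theorem rotateHomeo_point (i : Fin n) (x y : unitInterval) :
    S.rotateHomeo (S.point i x y) = S.rotate.point i (unitInterval.symm y) x := rfl

theorem isImageVia_rotate : IsImageVia ModularGroup.S S.u⁻¹ S S.rotate := by
  refine ⟨S.rotateHomeo, fun p => ?_, fun i => ?_⟩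
  · obtain ⟨i, x, y, rfl⟩ := S.exists_point p
    rw [rotateHomeo_point, proj_point, proj_point]
    simp [torusAct, ModularGroup.S, AddCircle.coe_period]
  · rw [vertex, rotateHomeo_point, unitInterval.symm_zero, point_right]
    rfl

/-! ### Periods -/

theorem turn_ne_iff {i : Fin n} : S.turn i ≠ i ↔ ∃ j, j ≠ i ∧ S.vertex j = S.vertex i := by
  refine ⟨fun h => ⟨_, h, S.vertex_turn i⟩, ?_⟩
  rintro ⟨j, hj, h⟩ hi
  exact hj ((S.vertex_eq_vertex_iff.1 h.symm).eq_of_left hi).symm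

section

variable {S} {S' : Origami n} {A : SL(2, ℤ)} {τ : Equiv.Perm (Fin n)}

theorem turn_apply_ne_iff_of_vertex {f : S.Surface ≃ₜ S'.Surface}
    (hf : ∀ i, f (S.vertex i) = S'.vertex (τ i)) {i : Fin n} :
    S'.turn (τ i) ≠ τ i ↔ S.turn i ≠ i := by
  rw [turn_ne_iff, turn_ne_iff, τ.surjective.exists]
  simp only [← hf, f.injective.eq_iff, τ.injective.ne_iff]

theorem apply_mem_sing_iff_of_vertex {f : S.Surface ≃ₜ S'.Surface}
    (hf : ∀ i, f (S.vertex i) = S'.vertex (τ i)) {x : S.Surface} : f x ∈ S'.sing ↔ x ∈ S.sing := by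
  change (∃ i, S'.turn i ≠ i ∧ f x = S'.vertex i) ↔ ∃ i, S.turn i ≠ i ∧ x = S.vertex i
  rw [τ.surjective.exists]
  simp only [← hf, f.injective.eq_iff, turn_apply_ne_iff_of_vertex hf]

theorem IsImageVia.turn_apply_ne_iff (h : IsImageVia A τ S S') {i : Fin n} :
    S'.turn (τ i) ≠ τ i ↔ S.turn i ≠ i :=
  let ⟨_, _, hf⟩ := h
  turn_apply_ne_iff_of_vertex hf

end

/-- The vector of `ℂ = ℝ²` with the integral coordinates `v`. -/
def latticePoint (v : Fin 2 → ℤ) : ℂ := ⟨v 0, v 1⟩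

theorem latticePoint_eq_zero_iff {v : Fin 2 → ℤ} : latticePoint v = 0 ↔ v = 0 := by
  simp [latticePoint, Complex.ext_iff, funext_iff, Fin.forall_fin_two]

theorem latticePoint_neg (v : Fin 2 → ℤ) : latticePoint (-v) = -latticePoint v := by
  apply Complex.ext <;> simp [latticePoint]

theorem torusMk_add (z w : ℂ) : torusMk (z + w) = torusMk z + torusMk w := by
  simp [torusMk]

theorem torusMk_mul_latticePoint_mulVec (A : SL(2, ℤ)) (t : ℝ) (v : Fin 2 → ℤ) :
    torusMk (t * latticePoint (A.1.mulVec v)) = torusAct A (torusMk (t * latticePoint v)) := by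
  simp only [torusMk, torusAct, latticePoint, Complex.re_ofReal_mul, Complex.im_ofReal_mul,
    Matrix.mulVec, dotProduct, Fin.sum_univ_two, ← AddCircle.coe_zsmul, ← AddCircle.coe_add,
    zsmul_eq_mul]
  congr 2 <;> push_cast <;> ring

variable {S} in
theorem proj_eq_zero_of_mem_sing {p : S.Surface} (hp : p ∈ S.sing) : S.proj p = 0 := by
  obtain ⟨i, -, rfl⟩ := hp
  exact S.proj_vertex i

namespace IsSaddleConnection

variable {S} {S' : Origami n} {A : SL(2, ℤ)} {τ : Equiv.Perm (Fin n)}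
  {γ : C(unitInterval, S.Surface)}

theorem torusMk_eq_zero {z : ℂ} (h : S.IsSaddleConnection γ z) : torusMk z = 0 := by
  simpa [proj_eq_zero_of_mem_sing h.target] using (h.straight 1).symm

theorem reverse {z : ℂ} (h : S.IsSaddleConnection γ z) :
    S.IsSaddleConnection (γ.comp ⟨unitInterval.symm, unitInterval.continuous_symm⟩) (-z) where
  ne_zero := neg_ne_zero.2 h.ne_zero
  source := by simpa using h.target
  target := by simpa using h.source
  interior t h₀ h₁ :=
    h.interior _ (unitInterval.lt_symm_comm.1 (by simpa)) (unitInterval.symm_lt_comm.1 (by simpa))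
  straight t := by
    have hz : torusMk (((unitInterval.symm t : ℝ) : ℂ) * z) = torusMk (t * -z + z) := by
      congr 1
      push_cast [unitInterval.coe_symm_eq]
      ring
    simpa [h.straight, torusMk_add, h.torusMk_eq_zero] using hz

theorem map {v : Fin 2 → ℤ} (h : S.IsSaddleConnection γ (latticePoint v))
    {f : S.Surface ≃ₜ S'.Surface} (hf : ∀ x, S'.proj (f x) = torusAct A (S.proj x))
    (hτ : ∀ i, f (S.vertex i) = S'.vertex (τ i)) :
    S'.IsSaddleConnection (ContinuousMap.comp f γ) (latticePoint (A.1.mulVec v)) where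
  ne_zero hv := by
    have hAv := inv_mulVec_mulVec A v
    rw [latticePoint_eq_zero_iff.1 hv, Matrix.mulVec_zero] at hAv
    exact h.ne_zero (latticePoint_eq_zero_iff.2 hAv.symm)
  source := (apply_mem_sing_iff_of_vertex hτ).2 h.source
  target := (apply_mem_sing_iff_of_vertex hτ).2 h.target
  interior t h₀ h₁ := (apply_mem_sing_iff_of_vertex hτ).not.2 (h.interior t h₀ h₁)
  straight t := by
    rw [torusMk_mul_latticePoint_mulVec, ← h.straight t, ← hf]
    rfl

end IsSaddleConnection

/-- The lattice vector `v` is a period of `S`, for squares of side `1`. -/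
def HasPeriod (v : Fin 2 → ℤ) : Prop := latticePoint v ∈ S.hol

theorem hol_eq_image : S.hol = latticePoint '' {v | S.HasPeriod v} := by
  refine Subset.antisymm ?_ (image_subset_iff.2 fun _ => id)
  rintro z ⟨γ, hγ⟩
  obtain ⟨hre, him⟩ := Prod.mk.inj hγ.torusMk_eq_zero
  obtain ⟨a, ha⟩ := (AddCircle.coe_eq_zero_iff 1).1 hre
  obtain ⟨b, hb⟩ := (AddCircle.coe_eq_zero_iff 1).1 him
  have ha' : (a : ℝ) = z.re := by simpa using ha
  have hb' : (b : ℝ) = z.im := by simpa using hb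
  have hab : latticePoint ![a, b] = z := Complex.ext ha' hb'
  exact ⟨![a, b], ⟨γ, by rwa [hab]⟩, hab⟩

section

variable {S} {v : Fin 2 → ℤ}

theorem HasPeriod.ne_zero (hv : S.HasPeriod v) : v ≠ 0 :=
  let ⟨_, hγ⟩ := hv
  latticePoint_eq_zero_iff.not.1 hγ.ne_zero

theorem HasPeriod.neg (hv : S.HasPeriod v) : S.HasPeriod (-v) :=
  let ⟨_, hγ⟩ := hv
  ⟨_, by rw [latticePoint_neg]; exact hγ.reverse⟩

theorem HasPeriod.pos (hv : S.HasPeriod v) : 0 < n :=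
  let ⟨_, hγ⟩ := hv
  let ⟨i, _⟩ := hγ.source
  i.pos

end

namespace IsImageVia

variable {S} {S' : Origami n} {A : SL(2, ℤ)} {τ : Equiv.Perm (Fin n)} {v : Fin 2 → ℤ}

theorem hasPeriod_mulVec (h : IsImageVia A τ S S') (hv : S.HasPeriod v) :
    S'.HasPeriod (A.1.mulVec v) := by
  obtain ⟨f, hf, hτ⟩ := h
  obtain ⟨γ, hγ⟩ := hv
  exact ⟨_, hγ.map hf hτ⟩

theorem hasPeriod_mulVec_iff (h : IsImageVia A τ S S') :
    S'.HasPeriod (A.1.mulVec v) ↔ S.HasPeriod v := by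
  refine ⟨fun hv => ?_, h.hasPeriod_mulVec⟩
  rw [← inv_mulVec_mulVec A v]
  exact h.symm.hasPeriod_mulVec hv

end IsImageVia

theorem point_zero_notMem_sing (i : Fin n) {t : unitInterval} (h₀ : 0 < t) (h₁ : t < 1) :
    S.point i t 0 ∉ S.sing := fun h => by
  have ht : ((t : ℝ) : UnitAddCircle) = ((0 : ℝ) : UnitAddCircle) :=
    (Prod.mk.inj (proj_eq_zero_of_mem_sing h)).1
  exact h₀.ne' (Subtype.ext (unitAddCircle_coe_injOn ⟨t.2.1, h₁⟩ (by simp) ht))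

theorem hasPeriod_one_zero_iff :
    S.HasPeriod ![1, 0] ↔ ∃ i, S.turn i ≠ i ∧ S.turn (S.r i) ≠ S.r i := by
  simp only [← vertex_mem_sing_iff]
  constructor
  · rintro ⟨γ, hγ⟩
    obtain ⟨i, hi₀, hi₁, -⟩ := exists_eq_point_of_forall_proj_eq γ fun t => by
      simpa [torusMk, latticePoint] using hγ.straight t
    exact ⟨i, hi₀ ▸ hγ.source, hi₁ ▸ hγ.target⟩
  · rintro ⟨i, hi₀, hi₁⟩
    refine ⟨⟨fun t => S.point i t 0, (S.continuous_point i).comp (Continuous.prodMk_left 0)⟩,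
      ?_, hi₀, ?_, fun t => S.point_zero_notMem_sing i, fun t => ?_⟩
    · simp [latticePoint, Complex.ext_iff]
    · simpa [vertex, point_right] using hi₁
    · simp [torusMk, latticePoint, proj_point]

variable {S} in
theorem hasPeriod_neg_iff {v : Fin 2 → ℤ} : S.HasPeriod (-v) ↔ S.HasPeriod v :=
  ⟨fun hv => by simpa using hv.neg, HasPeriod.neg⟩

theorem hasPeriod_int_one_iff (k : ℤ) : S.HasPeriod ![k, 1] ↔
    ∃ i, S.turn i ≠ i ∧ S.turn (S.u ((S.r ^ k) i)) ≠ S.u ((S.r ^ k) i) := by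
  let τ : Equiv.Perm (Fin n) := (S.shear (-k)).u⁻¹
  have h : IsImageVia (ModularGroup.S * ModularGroup.T ^ (-k)) τ S (S.shear (-k)).rotate := by
    simpa using (S.shear (-k)).isImageVia_rotate.trans (S.isShear_shear (-k)).isImageVia
  have hv : (ModularGroup.S * ModularGroup.T ^ (-k)).1.mulVec ![k, 1] = -![1, 0] := by
    rw [Matrix.SpecialLinearGroup.coe_mul, ModularGroup.coe_T_zpow, ModularGroup.coe_S]
    ext i
    fin_cases i <;> simp
  have hτ : τ * (S.u * S.r ^ k) = 1 := by simp [τ, shear]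
  rw [← h.hasPeriod_mulVec_iff, hv, hasPeriod_neg_iff, hasPeriod_one_zero_iff, τ.surjective.exists]
  change (∃ i, (S.shear (-k)).rotate.turn (τ i) ≠ τ i ∧
    (S.shear (-k)).rotate.turn (τ (τ i)) ≠ τ (τ i)) ↔ _
  simp only [h.turn_apply_ne_iff]
  rw [(S.u * S.r ^ k).surjective.exists]
  simp only [← Equiv.Perm.mul_apply, hτ]
  simp [and_comm]

end

section

/-! ### Evaluation of `L` -/

theorem lagrangeOfPeriods_le {P : Set ℂ} {E κ : ℝ}
    (h : ∀ w ∈ P, κ ≤ |w.re * w.im + E * w.re ^ 2|) :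
    lagrangeOfPeriods P ≤ (ENNReal.ofReal κ)⁻¹ := by
  unfold lagrangeOfPeriods
  set F := comap (fun w : ℂ => |w.im|) atTop ⊓ 𝓟 P
  have hinf : Tendsto (fun w : ℂ => |w.im|) F atTop := tendsto_comap.mono_left inf_le_left
  have hsmall {w : ℂ} (hw : w ∈ P) (him : 0 < |w.im|) :
      κ - |E| * (κ / |w.im|) ^ 2 ≤ |w.re| * |w.im| := by
    rcases le_total κ (|w.re| * |w.im|) with hle | hle
    · linarith [mul_nonneg (abs_nonneg E) (sq_nonneg (κ / |w.im|))]
    · have hsq : w.re ^ 2 ≤ (κ / |w.im|) ^ 2 :=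
        sq_le_sq' (abs_le.1 ((le_div_iff₀ him).2 hle)).1 (abs_le.1 ((le_div_iff₀ him).2 hle)).2
      have htri := (h w hw).trans (abs_add_le _ _)
      rw [abs_mul, abs_mul, abs_of_nonneg (sq_nonneg w.re)] at htri
      linarith [mul_le_mul_of_nonneg_left hsq (abs_nonneg E)]
  have hbound : Tendsto (fun w : ℂ => (ENNReal.ofReal (κ - |E| * (κ / |w.im|) ^ 2))⁻¹) F
      (𝓝 (ENNReal.ofReal κ)⁻¹) := by
    refine (ENNReal.tendsto_ofReal ?_).inv
    simpa using (((hinf.const_div_atTop κ).pow 2).const_mul |E|).const_sub κ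
  rcases F.eq_or_neBot with hF | hF
  · simp [hF]
  · refine (limsup_le_limsup ?_).trans_eq hbound.limsup_eq
    filter_upwards [hinf.eventually_gt_atTop 0,
      mem_inf_of_right (mem_principal_self P)] with w him hw
    exact ENNReal.inv_le_inv.2 (ENNReal.ofReal_le_ofReal (hsmall hw him))

theorem le_lagrangeOfPeriods {ι : Type*} {l : Filter ι} [l.NeBot] {P : Set ℂ} {E κ : ℝ}
    (hκ : 0 < κ) {w : ι → ℂ} (hw : ∀ k, w k ∈ P)
    (hform : ∀ k, |(w k).re * (w k).im + E * (w k).re ^ 2| = κ)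
    (hre : Tendsto (fun k => (w k).re) l (𝓝 0)) :
    (ENNReal.ofReal κ)⁻¹ ≤ lagrangeOfPeriods P := by
  have hprod : Tendsto (fun k => |(w k).re| * |(w k).im|) l (𝓝 κ) := by
    refine tendsto_iff_dist_tendsto_zero.2 (squeeze_zero (fun _ => dist_nonneg) (fun k => ?_)
      (by simpa using (hre.pow 2).const_mul |E|))
    calc dist (|(w k).re| * |(w k).im|) κ
        = |(|(w k).re * (w k).im| - |(w k).re * (w k).im + E * (w k).re ^ 2|)| := by
          rw [hform k, Real.dist_eq, abs_mul]
      _ ≤ |(w k).re * (w k).im - ((w k).re * (w k).im + E * (w k).re ^ 2)| :=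
          abs_abs_sub_abs_le _ _
      _ = |E| * (w k).re ^ 2 := by rw [sub_add_cancel_left, abs_neg, abs_mul, abs_sq]
  have hre_ne (k) : (w k).re ≠ 0 := fun hk => hκ.ne (by simpa [hk] using hform k)
  have him : Tendsto (fun k => |(w k).im|) l atTop := by
    have hpos : Tendsto (fun k => |(w k).re|) l (𝓝[>] 0) :=
      tendsto_nhdsWithin_iff.2 ⟨by simpa using hre.abs,
        Eventually.of_forall fun k => abs_pos.2 (hre_ne k)⟩
    refine (hprod.pos_mul_atTop hκ (tendsto_inv_nhdsGT_zero.comp hpos)).congr fun k => ?_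
    simp only [Function.comp_apply]
    field_simp [abs_ne_zero.2 (hre_ne k)]
  have hmap : map w l ≤ comap (fun v : ℂ => |v.im|) atTop ⊓ 𝓟 P :=
    le_inf (tendsto_comap_iff.2 him) (tendsto_principal.2 (Eventually.of_forall hw))
  calc (ENNReal.ofReal κ)⁻¹
      = limsup (fun k => (ENNReal.ofReal (|(w k).re| * |(w k).im|))⁻¹) l :=
        (ENNReal.tendsto_ofReal hprod).inv.limsup_eq.symm
    _ = limsup (fun v : ℂ => (ENNReal.ofReal (|v.re| * |v.im|))⁻¹) (map w l) := rfl
    _ ≤ lagrangeOfPeriods P := limsup_le_limsup_of_le hmap (by isBoundedDefault)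
        (by isBoundedDefault)

/-- The vector `v` rotated counterclockwise by `arctan α`, so that the direction `(α, 1)` becomes
vertical, and scaled by the factor which normalizes the area of `n` unit squares to `1`. -/
def normalizedPeriod (n : ℕ) (α : ℝ) (v : Fin 2 → ℤ) : ℂ :=
  Complex.exp (Real.arctan α * Complex.I) * (latticePoint v / (√n : ℝ))

variable {S : Origami n} {A : SL(2, ℤ)} {α : ℝ}

theorem lagrange_eq_lagrangeOfPeriods_image (S : Origami n) (α : ℝ) :
    S.lagrange α = lagrangeOfPeriods (normalizedPeriod n α '' {v | S.HasPeriod v}) := by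
  rw [lagrange, normHol, hol_eq_image, image_image, image_image]
  rfl

theorem normalizedPeriod_re (v : Fin 2 → ℤ) :
    (normalizedPeriod n α v).re = (v 0 - α * v 1) / (√(1 + α ^ 2) * √n) := by
  rw [normalizedPeriod, Complex.mul_re, Complex.div_ofReal_re, Complex.div_ofReal_im,
    Complex.exp_ofReal_mul_I_re, Complex.exp_ofReal_mul_I_im, Real.cos_arctan, Real.sin_arctan]
  simp only [latticePoint]
  ring

theorem normalizedPeriod_im (v : Fin 2 → ℤ) :
    (normalizedPeriod n α v).im = (α * v 0 + v 1) / (√(1 + α ^ 2) * √n) := by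
  rw [normalizedPeriod, Complex.mul_im, Complex.div_ofReal_re, Complex.div_ofReal_im,
    Complex.exp_ofReal_mul_I_re, Complex.exp_ofReal_mul_I_im, Real.cos_arctan, Real.sin_arctan]
  simp only [latticePoint]
  ring

/-- The derivative at `α` of the polynomial `c X ^ 2 + (d - a) X - b` of the fixed slopes of `A`. -/
def fixedSlopeDeriv (A : SL(2, ℤ)) (α : ℝ) : ℝ := 2 * A.1 1 0 * α + (A.1 1 1 - A.1 0 0)

theorem abs_fixedSlopeDeriv (hα : IsFixedSlope A α) :
    |fixedSlopeDeriv A α| = √(A.1.trace ^ 2 - 4) := by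
  have hdet : (A.1 0 0 * A.1 1 1 - A.1 0 1 * A.1 1 0 : ℝ) = 1 := by
    exact_mod_cast det_fin_two_eq_one A
  unfold IsFixedSlope at hα
  rw [← Real.sqrt_sq_eq_abs, fixedSlopeDeriv, Matrix.trace_fin_two]
  push_cast
  congr 1
  linear_combination 4 * A.1 1 0 * hα - 4 * hdet

theorem fixedSlopeDeriv_ne_zero (hα : IsFixedSlope A α) (hA : 2 < |A.1.trace|) :
    fixedSlopeDeriv A α ≠ 0 := by
  have htrace : (2 : ℝ) < |(A.1.trace : ℝ)| := by exact_mod_cast hA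
  rw [← abs_pos, abs_fixedSlopeDeriv hα, Real.sqrt_pos, ← sq_abs]
  nlinarith

theorem invariantForm_eq_normalizedPeriod (hn : n ≠ 0) (hα : IsFixedSlope A α)
    (hD : fixedSlopeDeriv A α ≠ 0) (v : Fin 2 → ℤ) :
    (invariantForm A v : ℝ) = n * fixedSlopeDeriv A α *
      ((normalizedPeriod n α v).re * (normalizedPeriod n α v).im +
        (A.1 1 0 * (1 + α ^ 2) / fixedSlopeDeriv A α - α) * (normalizedPeriod n α v).re ^ 2) := by
  have hs : (√(1 + α ^ 2) * √n) ^ 2 = (1 + α ^ 2) * n := by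
    rw [mul_pow, Real.sq_sqrt (by positivity), Real.sq_sqrt (by positivity)]
  have hn' : (n : ℝ) ≠ 0 := by exact_mod_cast hn
  have hα' : 1 + α ^ 2 ≠ 0 := by positivity
  rw [normalizedPeriod_re, normalizedPeriod_im, div_mul_div_comm, div_pow, ← sq, hs]
  field_simp
  rw [invariantForm_eq, fixedSlopeDeriv]
  unfold IsFixedSlope at hα
  push_cast
  linear_combination (v 1 : ℝ) ^ 2 * (1 + α ^ 2) * hα

theorem lagrange_eq_of_isLeast (hP : ∀ v, S.HasPeriod (A.1.mulVec v) ↔ S.HasPeriod v)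
    (hA : 2 < |A.1.trace|) (hα : IsFixedSlope A α) {m : ℤ}
    (hm : IsLeast ((fun v => |invariantForm A v|) '' {v | S.HasPeriod v}) m) :
    S.lagrange α = ENNReal.ofReal (n * √(A.1.trace ^ 2 - 4) / m) := by
  obtain ⟨⟨v, hv, rfl⟩, hmin⟩ := hm
  dsimp only at *
  have hn : 0 < (n : ℝ) := by exact_mod_cast hv.pos
  have hD : 0 < |fixedSlopeDeriv A α| := abs_pos.2 (fixedSlopeDeriv_ne_zero hα hA)
  let E := A.1 1 0 * (1 + α ^ 2) / fixedSlopeDeriv A α - α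
  have hform (w : Fin 2 → ℤ) : |(normalizedPeriod n α w).re * (normalizedPeriod n α w).im +
      E * (normalizedPeriod n α w).re ^ 2| =
      |invariantForm A w| / (n * |fixedSlopeDeriv A α|) := by
    rw [Int.cast_abs, invariantForm_eq_normalizedPeriod hv.pos.ne' hα (abs_pos.1 hD), abs_mul,
      abs_mul, abs_of_pos hn, mul_div_cancel_left₀ _ (mul_pos hn hD).ne']
  have hm : 0 < (|invariantForm A v| / (n * |fixedSlopeDeriv A α|) : ℝ) :=
    div_pos (by exact_mod_cast abs_pos.2 (invariantForm_ne_zero hA hv.ne_zero)) (mul_pos hn hD)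
  rw [← abs_fixedSlopeDeriv hα, ← inv_div, ENNReal.ofReal_inv_of_pos (by exact_mod_cast hm),
    lagrange_eq_lagrangeOfPeriods_image]
  refine le_antisymm (lagrangeOfPeriods_le (E := E) (forall_mem_image.2 fun w hw => ?_)) ?_
  · rw [hform]
    gcongr ?_ / _
    exact_mod_cast hmin (mem_image_of_mem _ hw)
  · obtain ⟨p, hp, hlim⟩ := hα.exists_tendsto_sub_mul hP hA hv
    refine le_lagrangeOfPeriods (l := atTop) (E := E) (w := fun k => normalizedPeriod n α (p k))
      (by exact_mod_cast hm) (fun k => mem_image_of_mem _ (hp k).1)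
      (fun k => by rw [hform, (hp k).2]) ?_
    simpa only [normalizedPeriod_re, zero_div] using hlim.div_const _

end

section

/-! ### Even loops with a period of length two -/

variable {S S' : Origami n} {a b : ℕ} {σ : Equiv.Perm (Fin n)}

theorem exists_isImageVia_gWord_pair (h : IsShear (-b) σ (S.rotate.shear a).rotate S') :
    ∃ τ, IsImageVia (gWord [a, b]) τ S S' := by
  rw [gWord_pair]
  exact ⟨_, h.isImageVia.trans <| (S.rotate.shear a).isImageVia_rotate.trans <|
    (S.rotate.isShear_shear a).isImageVia.trans S.isImageVia_rotate⟩

theorem HasPeriod.exists_reduced (h : IsShear (-b) σ (S.rotate.shear a).rotate S) (ha : 0 < a)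
    {v : Fin 2 → ℤ} (hv : S.HasPeriod v) :
    ∃ w, S.HasPeriod w ∧ 0 ≤ w 1 ∧
      a * w 0 ^ 2 + a * b * w 0 * w 1 - b * w 1 ^ 2 = invariantForm (gWord [a, b]) v ∧
      b * w 1 ^ 2 ≤ |invariantForm (gWord [a, b]) v| := by
  obtain ⟨τ, hτ⟩ := exists_isImageVia_gWord_pair h
  obtain ⟨w, hw, hform, hle⟩ := exists_reduced_invariantForm (fun v => hτ.hasPeriod_mulVec_iff) hv
  have hbound : b * w 1 ^ 2 ≤ |invariantForm (gWord [a, b]) v| := by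
    rw [trace_gWord_pair, gWord_pair_val, abs_mul, abs_neg, abs_of_nonneg (by positivity)] at hle
    simp only [Matrix.of_apply, Matrix.cons_val, Nat.abs_cast] at hle
    exact le_of_mul_le_mul_left (by linarith) (Int.natCast_pos.2 ha)
  rw [invariantForm_gWord_pair] at hform
  rcases le_total 0 (w 1) with hw₁ | hw₁
  · exact ⟨w, hw, hw₁, hform, hbound⟩
  · refine ⟨-w, hw.neg, by simpa using hw₁, ?_, by simpa using hbound⟩
    rw [← hform, Pi.neg_apply, Pi.neg_apply]
    ring

theorem lagrange_periodicCF_pair (h : IsShear (-b) σ (S.rotate.shear a).rotate S) (ha : 0 < a)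
    (hb : 0 < b) {m : ℤ}
    (hm : IsLeast ((fun v => |invariantForm (gWord [a, b]) v|) '' {v | S.HasPeriod v}) m) :
    S.lagrange (periodicCF [] [a, b]) = ENNReal.ofReal (n * √(a * b * (a * b + 4)) / m) := by
  obtain ⟨τ, hτ⟩ := exists_isImageVia_gWord_pair h
  rw [lagrange_eq_of_isLeast (fun v => hτ.hasPeriod_mulVec_iff) (two_lt_abs_trace_gWord_pair ha hb)
    (isFixedSlope_gWord_pair ha hb) hm, trace_gWord_pair]
  congr 4
  push_cast
  ring

theorem isEvenLoop_pair {X : Origami 7} {σ : Equiv.Perm (Fin 7)} (hX : X ∈ orbitB7) (ha : 0 < a)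
    (hb : 0 < b) (h : IsShear (-b) σ (X.rotate.shear a).rotate X) : IsEvenLoop X [a, b] where
  mem := hX
  ne_nil := by simp
  even := even_two
  pos := by simp [ha, hb]
  quadratic := (isFixedSlope_gWord_pair ha hb).isQuadraticIrrational
    (two_lt_abs_trace_gWord_pair ha hb)
  loop := (exists_isImageVia_gWord_pair h).choose_spec.isImage

/-! ### Membership in the orbit B7 -/

theorem isPrimitive_of_hasPeriod {k : ℤ} (h : S.HasPeriod ![k, 1]) (h' : S.HasPeriod ![k + 1, 1]) :
    S.IsPrimitive := by
  refine Subset.antisymm (fun z hz => ?_) ?_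
  · induction hz using AddSubgroup.closure_induction with
    | mem z hz =>
      obtain ⟨v, -, rfl⟩ := S.hol_eq_image ▸ hz
      exact ⟨v 0, v 1, by apply Complex.ext <;> simp [latticePoint]⟩
    | zero => exact ⟨0, 0, by simp⟩
    | add z w _ _ hz hw =>
      obtain ⟨⟨x, y, rfl⟩, x', y', rfl⟩ := And.intro hz hw
      exact ⟨x + x', y + y', by push_cast; ring⟩
    | neg z _ hz =>
      obtain ⟨x, y, rfl⟩ := hz
      exact ⟨-x, -y, by push_cast; ring⟩
  · rintro _ ⟨x, y, rfl⟩
    have hxy : (x + y * Complex.I : ℂ) = ((k + 1) * y - x) • latticePoint ![k, 1] +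
        (x - k * y) • latticePoint ![k + 1, 1] := by
      apply Complex.ext <;> simp [latticePoint] <;> ring
    rw [hxy]
    exact add_mem (zsmul_mem (AddSubgroup.subset_closure h) _)
      (zsmul_mem (AddSubgroup.subset_closure h') _)

theorem ncard_fixed_vertices {τ : Equiv.Perm (Fin n)} (hS : S.IsH2)
    (hτ : ∀ i, S.turn (τ i) ≠ τ i ↔ S.turn i ≠ i) :
    {x | ∃ i, S.vertex (τ i) = S.vertex i ∧ x = S.vertex i}.ncard =
      {i | S.turn i = i ∧ τ i = i}.ncard + 1 := by
  obtain ⟨i₀, hi₀, -⟩ := hS.isCycle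
  have hset : {x | ∃ i, S.vertex (τ i) = S.vertex i ∧ x = S.vertex i} =
      insert (S.vertex i₀) (S.vertex '' {i | S.turn i = i ∧ τ i = i}) := by
    ext x
    constructor
    · rintro ⟨i, hi, rfl⟩
      by_cases hfix : S.turn i = i
      · exact .inr ⟨i, ⟨hfix, ((S.vertex_eq_vertex_iff.1 hi.symm).eq_of_left hfix).symm⟩, rfl⟩
      · exact .inl (S.vertex_eq_vertex_iff.2 (hS.isCycle.sameCycle hfix hi₀))
    · rintro (rfl | ⟨i, hi, rfl⟩)
      · exact ⟨i₀, S.vertex_eq_vertex_iff.2 (hS.isCycle.sameCycle ((hτ i₀).2 hi₀) hi₀), rfl⟩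
      · exact ⟨i, by rw [hi.2], rfl⟩
  have hinj : InjOn S.vertex {i | S.turn i = i ∧ τ i = i} := fun i hi j _ hij =>
    (S.vertex_eq_vertex_iff.1 hij).eq_of_left hi.1
  rw [hset, ncard_insert_of_notMem, hinj.ncard_image]
  rintro ⟨i, hi, hii₀⟩
  exact hi₀ ((S.vertex_eq_vertex_iff.1 hii₀).eq_of_left hi.1 ▸ hi.1)

theorem hasThreeIntegerWeierstrassPoints_of_isImageVia {τ : Equiv.Perm (Fin n)} (hS : S.IsH2)
    (h : IsImageVia (-1) τ S S) (hτ : {i | S.turn i = i ∧ τ i = i}.ncard = 2) :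
    S.HasThreeIntegerWeierstrassPoints := by
  obtain ⟨f, hf, hfτ⟩ := id h
  refine ⟨f, hf, ?_⟩
  rw [← show {i | S.turn i = i ∧ τ i = i}.ncard + 1 = 3 by rw [hτ],
    ← ncard_fixed_vertices hS fun i => h.turn_apply_ne_iff]
  congr 1
  ext x
  constructor
  · rintro ⟨hx, hx₀⟩
    obtain ⟨i, rfl⟩ := exists_eq_vertex_of_proj_eq_zero hx₀
    exact ⟨i, hfτ i ▸ hx, rfl⟩
  · rintro ⟨i, hi, rfl⟩
    exact ⟨by rw [hfτ, hi], S.proj_vertex i⟩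

theorem isImageVia_neg_one (h : IsShear 0 σ S.rotate.rotate S) :
    IsImageVia (-1) (σ * (S.r⁻¹ * S.u⁻¹)) S S := by
  have hSS : (-1 : SL(2, ℤ)) = ModularGroup.T ^ (0 : ℤ) * (ModularGroup.S * ModularGroup.S) := by
    decide
  rw [hSS]
  exact h.isImageVia.trans (S.rotate.isImageVia_rotate.trans S.isImageVia_rotate)

theorem mem_orbitB7_of_isShear {X : Origami 7} {σ : Equiv.Perm (Fin 7)} {k : ℤ}
    (h : X.HasPeriod ![k, 1]) (h' : X.HasPeriod ![k + 1, 1]) (hX : X.IsH2)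
    (hσ : IsShear 0 σ X.rotate.rotate X)
    (hfix : {i | X.turn i = i ∧ (σ * (X.r⁻¹ * X.u⁻¹)) i = i}.ncard = 2) : X ∈ orbitB7 :=
  ⟨isPrimitive_of_hasPeriod h h', hX,
    hasThreeIntegerWeierstrassPoints_of_isImageVia hX (isImageVia_neg_one hσ) hfix⟩

end

/-! ### The loops on `C_6` and `C_3` -/

theorem not_hasPeriod_one_zero_cuspC (j : Fin 7) : ¬ (cuspC j).HasPeriod ![1, 0] := by
  rw [hasPeriod_one_zero_iff]
  revert j
  decide

theorem one_lt_abs_of_hasPeriod_cuspC {j : Fin 7} {v : Fin 2 → ℤ} (hv : (cuspC j).HasPeriod v)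
    (hv₁ : v 1 = 0) : 1 < |v 0| := by
  have hv₀ : v 0 ≠ 0 := fun hv₀ => hv.ne_zero (funext (Fin.forall_fin_two.2 ⟨hv₀, hv₁⟩))
  by_contra! hle
  rcases eq_or_eq_neg_of_abs_eq (le_antisymm hle (Int.one_le_abs hv₀)) with h | h
  · have hv_eq : v = ![1, 0] := funext (Fin.forall_fin_two.2 ⟨h, hv₁⟩)
    exact not_hasPeriod_one_zero_cuspC j (hv_eq ▸ hv)
  · have hv_eq : -v = ![1, 0] := funext (Fin.forall_fin_two.2 ⟨by simp [h], by simp [hv₁]⟩)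
    exact not_hasPeriod_one_zero_cuspC j (hv_eq ▸ hv.neg)

theorem exists_isShear_cuspC_six :
    ∃ σ, IsShear (-(3 : ℕ)) σ ((cuspC 6).rotate.shear (1 : ℕ)).rotate (cuspC 6) :=
  ⟨⟨![4, 5, 1, 0, 6, 2, 3], ![3, 2, 5, 6, 0, 1, 4], by decide, by decide⟩, by decide, by decide⟩

theorem exists_isShear_cuspC_three :
    ∃ σ, IsShear (-(2 : ℕ)) σ ((cuspC 3).rotate.shear (5 : ℕ)).rotate (cuspC 3) :=
  ⟨⟨![2, 3, 0, 1, 4, 5, 6], ![2, 3, 0, 1, 4, 5, 6], by decide, by decide⟩, by decide, by decide⟩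

theorem isH2_cuspC (j : Fin 7) : (cuspC j).IsH2 := by
  rw [IsH2, ← card_support_eq_three_iff]
  revert j
  decide

theorem cuspC_six_mem_orbitB7 : cuspC 6 ∈ orbitB7 := by
  refine mem_orbitB7_of_isShear (k := -1)
    (σ := ⟨![5, 4, 3, 2, 1, 0, 6], ![5, 4, 3, 2, 1, 0, 6], by decide, by decide⟩)
    ?_ ?_ (isH2_cuspC 6) ⟨by decide, by decide⟩ ?_
  · exact (hasPeriod_int_one_iff _ _).2 (by decide)
  · exact (hasPeriod_int_one_iff _ _).2 (by decide)
  · rw [Set.ncard_eq_toFinset_card']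
    decide

theorem cuspC_three_mem_orbitB7 : cuspC 3 ∈ orbitB7 := by
  refine mem_orbitB7_of_isShear (k := 3)
    (σ := ⟨![2, 1, 0, 6, 5, 4, 3], ![2, 1, 0, 6, 5, 4, 3], by decide, by decide⟩)
    ?_ ?_ (isH2_cuspC 3) ⟨by decide, by decide⟩ ?_
  · exact (hasPeriod_int_one_iff _ _).2 (by decide)
  · exact (hasPeriod_int_one_iff _ _).2 (by decide)
  · rw [Set.ncard_eq_toFinset_card']
    decide

theorem isLeast_invariantForm_cuspC_six :
    IsLeast ((fun v => |invariantForm (gWord [1, 3]) v|) '' {v | (cuspC 6).HasPeriod v}) 3 := by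
  refine ⟨⟨![0, 1], (hasPeriod_int_one_iff _ _).2 (by decide), ?_⟩,
    forall_mem_image.2 fun v hv => ?_⟩
  · simp [invariantForm_gWord_pair]
  · by_contra! hlt
    obtain ⟨σ, hσ⟩ := exists_isShear_cuspC_six
    obtain ⟨w, hw, -, hform, hle⟩ := HasPeriod.exists_reduced hσ one_pos hv
    push_cast at hform hle
    have hw₁ : w 1 = 0 := by
      by_contra hne
      nlinarith [sq_pos_of_ne_zero hne]
    rw [← hform, hw₁] at hlt
    have hw₀ := one_lt_abs_of_hasPeriod_cuspC hw hw₁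
    norm_num at hlt
    rw [← sq_abs] at hlt
    nlinarith

theorem isLeast_invariantForm_cuspC_three :
    IsLeast ((fun v => |invariantForm (gWord [5, 2]) v|) '' {v | (cuspC 3).HasPeriod v}) 7 := by
  refine ⟨⟨![-1, 1], (hasPeriod_int_one_iff _ _).2 (by decide), ?_⟩,
    forall_mem_image.2 fun v hv => ?_⟩
  · simp [invariantForm_gWord_pair]
  · by_contra! hlt
    obtain ⟨σ, hσ⟩ := exists_isShear_cuspC_three
    obtain ⟨w, hw, hw₁, hform, hle⟩ := HasPeriod.exists_reduced hσ (by simp) hv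
    push_cast at hform hle
    have hw₁' : w 1 ≤ 1 := by nlinarith
    rw [← hform, abs_lt] at hlt
    interval_cases hy : w 1
    · have hw₀ := one_lt_abs_of_hasPeriod_cuspC hw hy
      nlinarith [sq_abs (w 0)]
    · have hw₀ : w 0 = 0 ∨ w 0 = -2 := by
        have hlow : -3 < w 0 := by nlinarith
        have hupp : w 0 < 1 := by nlinarith
        interval_cases w 0 <;> omega
      rcases hw₀ with hx | hx
      · rw [(funext (Fin.forall_fin_two.2 ⟨hx, hy⟩) : w = ![0, 1]), hasPeriod_int_one_iff] at hw
        exact absurd hw (by decide)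
      · rw [(funext (Fin.forall_fin_two.2 ⟨hx, hy⟩) : w = ![-2, 1]), hasPeriod_int_one_iff] at hw
        exact absurd hw (by decide)

theorem lagrange_cuspC_six :
    (cuspC 6).lagrange (periodicCF [] [1, 3]) = ENNReal.ofReal (7 * √21 / 3) := by
  obtain ⟨σ, hσ⟩ := exists_isShear_cuspC_six
  rw [lagrange_periodicCF_pair hσ (by norm_num) (by norm_num) isLeast_invariantForm_cuspC_six]
  norm_num

theorem lagrange_cuspC_three :
    (cuspC 3).lagrange (periodicCF [] [5, 2]) = ENNReal.ofReal (2 * √35) := by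
  obtain ⟨σ, hσ⟩ := exists_isShear_cuspC_three
  rw [lagrange_periodicCF_pair hσ (by norm_num) (by norm_num) isLeast_invariantForm_cuspC_three]
  norm_num [sqrt_140]

end Origami

end

theorem mainTheorem6 :
    (IsEvenLoop (cuspC 6) [1, 3] ∧ IsEvenLoop (cuspC 3) [5, 2]) ∧
    ((cuspC 6).lagrange (periodicCF [] [1, 3]) = ENNReal.ofReal phi1 ∧
      phi1 = 7 + 14 * periodicCF [] [3, 1] ∧ phi1 = 7 * Real.sqrt 21 / 3) ∧
    ((cuspC 3).lagrange (periodicCF [] [5, 2]) = ENNReal.ofReal (14 * periodicCF [1] [5, 2]) ∧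
      |14 * periodicCF [1] [5, 2] - 11.832159| ≤ (10 : ℝ) ^ (-6 : ℤ)) := by
  obtain ⟨σ₆, hσ₆⟩ := Origami.exists_isShear_cuspC_six
  obtain ⟨σ₃, hσ₃⟩ := Origami.exists_isShear_cuspC_three
  have hvalue : 14 * periodicCF [1] [5, 2] = 2 * √35 := by
    rw [periodicCF_one_five_two]
    ring
  refine ⟨⟨Origami.isEvenLoop_pair Origami.cuspC_six_mem_orbitB7 one_pos three_pos hσ₆,
    Origami.isEvenLoop_pair Origami.cuspC_three_mem_orbitB7 (by norm_num) two_pos hσ₃⟩,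
    ⟨?_, rfl, phi1_eq⟩, ?_, ?_⟩
  · rw [phi1_eq, Origami.lagrange_cuspC_six]
  · rw [hvalue, Origami.lagrange_cuspC_three]
  · have hlow : (5.916079 : ℝ) ≤ √35 := Real.le_sqrt_of_sq_le (by norm_num)
    have hupp : √35 ≤ (5.91608 : ℝ) := Real.sqrt_le_iff.2 (by norm_num)
    rw [hvalue, abs_le]
    norm_num
    constructor <;> linarith
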